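/- Let $V$ be a finite alphabet and let $\$\notin V$ be an end-of-string symbol. A weighted language is a function $\tilde p:V^*\to\mathbb{R}_{\ge 0}$. It is normalizable if $Z=\sum_{x\in V^*}\tilde p(x)$ is finite and strictly positive; its normalized version is then $p=\tilde p/Z$. For $\hat x\in V^*$ let $Z(\hat x)$ be the sum of $\tilde p(x)$ over all $x\in V^*$ that have $\hat x$ as a prefix. If $Z(\hat x)>0$, the local conditional probabilities are $p(v\mid\hat x)=Z(\hat x v)/Z(\hat x)$ for $v\in V$, and $p(\$\mid\hat x)=1-\sum_{v\in V}p(v\mid\hat x)$. A parametric model is a Turing machine $M$ that reads a bit string $\theta$ and outputs the description of a Turing machine $M(\theta)$. Turing machines are deterministic, with a fixed finite number of tapes and a fixed finite tape alphabet (the machines constructed by one model $M$ have the same number of tapes and the same alphabet), and output rational numbers as fractions of two binary numerals. A weighted language $r$ is efficiently computable with compact parameters if there are a parametric model $M$ and bit strings $(\theta_n)_{n\in\mathbb{N}}$ such that, with $r_n=M(\theta_n)$: $|\theta_n|=O(\mathrm{poly}(n))$; $M$ constructs $r_n$ from $\theta_n$ in time $O(\mathrm{poly}(n))$; and for every $x\in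 V^*$ of length $n$, $r_n$ on input $x$ outputs $r(x)$ in time $O(\mathrm{poly}(n))$. A parametric model $M^{\mathrm q}$ efficiently locally normalizes $\tilde p$ with compact parameters $(\theta_n)_{n\in\mathbb{N}}$ if $\tilde p$ is normalizable and, with $q_n=M^{\mathrm q}(\theta_n)$: $q_n$ on input $\hat x s$ outputs $p(s\mid\hat x)$ for all $s\in V\cup\{\$\}$ and all $\hat x\in V^*$ with $|\hat x|\le n$ and $Z(\hat x)>0$; $|\theta_n|=O(\mathrm{poly}(n))$; $M^{\mathrm q}$ constructs $q_n$ from $\theta_n$ in time $O(\mathrm{poly}(n))$; and the running time of $q_n$ on all inputs $\hat x s$ with $\hat x\in V^*$, $|\hat x|\le n$, $s\in V\cup\{\$\}$ is $O(\mathrm{poly}(n))$. Lemma. Let $M^{\mathrm q}$ be a Turing machine that efficiently locally normalizes a weighted language $\tilde p$ with compact parameters $(\theta_n)_{n\in\mathbb{N}}$. Then $p=\tilde p/Z$ is efficiently computable with compact parameters. -/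

import Mathlib

open scoped NNReal

noncomputable section

namespace SeqModel

/-! ### Multitape Turing machines -/

/-- One entry of the transition table of a Turing machine with `k + 1` tapes over the tape
alphabet `Γ`: in state `src`, when the scanned symbols are `read`, go to state `tgt`, write the
symbols `write`, and then move each head (`none` means that the head stays). -/
structure Rule (k : ℕ) (Γ : Type*) where
  src : ℕ
  read : Fin (k + 1) → Γ
  tgt : ℕ
  write : Fin (k + 1) → Γ
  move : Fin (k + 1) → Option Turing.Dir

/-- A deterministic Turing machine with `k + 1` two-way infinite tapes, given by its finite
transition table (the first applicable entry is used). States are natural numbers; `0` is the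
initial state and `1` is the halting state. -/
structure TM (k : ℕ) (Γ : Type*) where
  rules : List (Rule k Γ)

/-- A configuration: the state, and the tapes with their head positions. The blank symbol is
the default element of `Γ`. -/
structure Cfg (k : ℕ) (Γ : Type*) [Inhabited Γ] where
  state : ℕ
  tape : Fin (k + 1) → Turing.Tape Γ

namespace TM

variable {k : ℕ} {Γ : Type*} [Inhabited Γ]

/-- The effect of a transition on one tape. -/
def act (T : Turing.Tape Γ) (a : Γ) (d : Option Turing.Dir) : Turing.Tape Γ :=
  match d with
  | none => T.write a
  | some d => (T.write a).move d

open Classical in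
/-- One step. A configuration in the halting state does not change any more. If no table entry
applies in another state, then the machine is stuck there forever (and does not halt). -/
def step (M : TM k Γ) (c : Cfg k Γ) : Cfg k Γ :=
  if c.state = 1 then c
  else
    match M.rules.find? (fun r => decide (r.src = c.state ∧ r.read = fun i => (c.tape i).head)) with
    | none => c
    | some r => ⟨r.tgt, fun i => act (c.tape i) (r.write i) (r.move i)⟩

/-- The initial configuration: the input is on tape `0`, with the head on its first symbol, and
the other tapes are blank. -/
def init (k : ℕ) (input : List Γ) : Cfg k Γ :=
  ⟨0, fun i => if i = 0 then Turing.Tape.mk₁ input else Turing.Tape.mk₁ []⟩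

/-- The configuration after `t` steps. -/
def run (M : TM k Γ) (input : List Γ) (t : ℕ) : Cfg k Γ :=
  M.step^[t] (init k input)

/-- `M` halts on `input` after at most `t` steps. -/
def HaltsWithin (M : TM k Γ) (input : List Γ) (t : ℕ) : Prop :=
  (M.run input t).state = 1

/-- `M` halts on `input` after at most `t` steps with output `w`: from the head of tape `0`
rightwards, that tape holds `w`, followed by blanks only. -/
def OutputsWithin (M : TM k Γ) (input w : List Γ) (t : ℕ) : Prop :=
  M.HaltsWithin input t ∧
    ((M.run input t).tape 0).right₀ = Turing.ListBlank.mk w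

/-- `M` halts on `input` with output `w`. -/
def Outputs (M : TM k Γ) (input w : List Γ) : Prop :=
  ∃ t, M.OutputsWithin input w t

end TM

/-! ### Tape alphabet, strings and rational numbers on tapes, descriptions of machines -/

/-- The tape alphabet of machines that handle strings over `V`: a blank, the bits, a fraction
bar, the end-of-string symbol, the symbols of `V`, and `g` auxiliary symbols. -/
inductive Sym (V : Type*) (g : ℕ) where
  | blank
  | bit (b : Bool)
  | slash
  | eos
  | letter (v : V)
  | aux (i : Fin g)

instance (V : Type*) (g : ℕ) : Inhabited (Sym V g) := ⟨Sym.blank⟩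

/-- A numbering of the tape alphabet. -/
def Sym.code {V : Type*} [Fintype V] {g : ℕ} : Sym V g → ℕ
  | blank => 0
  | bit false => 1
  | bit true => 2
  | slash => 3
  | eos => 4
  | letter v => 5 + (Fintype.equivFin V v : ℕ)
  | aux i => 5 + Fintype.card V + (i : ℕ)

/-- A bit string as a tape word. -/
def bitWord (V : Type*) (g : ℕ) (w : List Bool) : List (Sym V g) :=
  w.map Sym.bit

/-- A string over `V` as a tape word. -/
def strWord {V : Type*} (g : ℕ) (x : List V) : List (Sym V g) :=
  x.map Sym.letter

/-- A symbol of `V ∪ {$}` as a tape symbol, where `none` stands for `$`. -/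
def nextSym {V : Type*} (g : ℕ) : Option V → Sym V g
  | none => Sym.eos
  | some v => Sym.letter v

/-- The number written in binary by `w`, least significant bit first. -/
def binVal (w : List Bool) : ℕ :=
  Nat.ofDigits 2 (w.map Bool.toNat)

/-- The machine `M` halts on `input` with output a fraction `a/b` of two binary numerals,
not necessarily in lowest terms, whose value is `r`. -/
def OutputsRat {V : Type*} {g k : ℕ} (M : TM k (Sym V g)) (input : List (Sym V g)) (r : ℝ) :
    Prop :=
  ∃ a b : List Bool, binVal b ≠ 0 ∧ r = (binVal a : ℝ) / (binVal b : ℝ) ∧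
    M.Outputs input (bitWord V g a ++ Sym.slash :: bitWord V g b)

/-- The self-delimiting code `1…10` of a natural number. -/
def encNat (n : ℕ) : List Bool :=
  List.replicate n true ++ [false]

/-- The code of a head movement. -/
def encMove : Option Turing.Dir → List Bool
  | none => encNat 0
  | some Turing.Dir.left => encNat 1
  | some Turing.Dir.right => encNat 2

/-- The code of one entry of a transition table. -/
def Rule.encode {V : Type*} [Fintype V] {g k : ℕ} (r : Rule k (Sym V g)) : List Bool :=
  encNat r.src ++ (List.ofFn fun i => encNat (r.read i).code).flatten ++
    encNat r.tgt ++ (List.ofFn fun i => encNat (r.write i).code ++ encMove (r.move i)).flatten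

/-- The description of a Turing machine as a bit string: the codes of the entries of its
transition table one after the other. -/
def TM.encode {V : Type*} [Fintype V] {g k : ℕ} (M : TM k (Sym V g)) : List Bool :=
  M.rules.flatMap Rule.encode

/-! ### Weighted languages -/

/-- A weighted language over `V`. -/
abbrev WeightedLanguage (V : Type*) := List V → ℝ≥0

namespace WeightedLanguage

variable {V : Type*}

/-- The global normalizing constant. -/
def Z (p : WeightedLanguage V) : ℝ≥0 :=
  ∑' x, p x

/-- The global normalizing constant is finite and strictly positive. -/
def Normalizable (p : WeightedLanguage V) : Prop :=
  Summable p ∧ 0 < p.Z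

/-- The normalized version of a weighted language. -/
def normalized (p : WeightedLanguage V) : WeightedLanguage V :=
  fun x => p x / p.Z

/-- The total weight of the strings with prefix `y`. -/
def prefixZ (p : WeightedLanguage V) (y : List V) : ℝ≥0 :=
  ∑' x : {x : List V // y <+: x}, p x

/-- The local conditional probability of a next symbol in `V ∪ {$}` (where `none` stands for
`$`) after the prefix `y`; it is meaningful if `0 < p.prefixZ y`. -/
def localProb [Fintype V] (p : WeightedLanguage V) (y : List V) : Option V → ℝ
  | some v => (p.prefixZ (y ++ [v]) : ℝ) / (p.prefixZ y : ℝ)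
  | none => 1 - ∑ v, (p.prefixZ (y ++ [v]) : ℝ) / (p.prefixZ y : ℝ)

end WeightedLanguage

/-! ### Parametric models and compact parameters -/

/-- A general-purpose Turing machine `machine` that reads parameters (a bit string) and writes the
description of a specialized Turing machine with `outTapes + 1` tapes. Both kinds of machines use
a tape alphabet with `numAux` auxiliary symbols. -/
structure ParametricModel (V : Type*) where
  numAux : ℕ
  tapes : ℕ
  outTapes : ℕ
  machine : TM tapes (Sym V numAux)

namespace ParametricModel

variable {V : Type*} [Fintype V]

/-- The specialized machines that a parametric model constructs. -/
abbrev Specialized (M : ParametricModel V) : Type _ :=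
  TM M.outTapes (Sym V M.numAux)

/-- From the parameters `θ`, the model constructs the specialized machine `q` in at most `t`
steps. -/
def ConstructsWithin (M : ParametricModel V) (θ : List Bool) (q : M.Specialized) (t : ℕ) : Prop :=
  M.machine.OutputsWithin (bitWord V M.numAux θ) (bitWord V M.numAux q.encode) t

/-- The model `M` with the parameters `θ 0, θ 1, …` computes the weighted language `p`
efficiently, and the parameters are compact: all of the parameter size, the time to construct the
`n`-th specialized machine `q n`, and the time of `q n` on strings of length `n` are `O(poly n)`. -/
def EfficientlyComputes (M : ParametricModel V) (θ : ℕ → List Bool) (p : WeightedLanguage V) :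
    Prop :=
  ∃ q : ℕ → M.Specialized,
    (∃ P : Polynomial ℕ, ∀ n, (θ n).length ≤ P.eval n) ∧
    (∃ P : Polynomial ℕ, ∀ n, M.ConstructsWithin (θ n) (q n) (P.eval n)) ∧
    (∀ x : List V, OutputsRat (q x.length) (strWord M.numAux x) (p x : ℝ)) ∧
    (∃ P : Polynomial ℕ, ∀ x : List V,
      (q x.length).HaltsWithin (strWord M.numAux x) (P.eval x.length))

/-- The model `M` efficiently locally normalizes `p` with compact parameters `θ 0, θ 1, …`.
The specialized machine `q n` has to give the local conditional probabilities after all prefixes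
of length at most `n` after which they are defined, and to respect its time bound after all
prefixes of length at most `n`. -/
def EfficientlyLocallyNormalizes (M : ParametricModel V) (θ : ℕ → List Bool)
    (p : WeightedLanguage V) : Prop :=
  p.Normalizable ∧
  ∃ q : ℕ → M.Specialized,
    (∀ (n : ℕ) (y : List V) (s : Option V), y.length ≤ n → 0 < p.prefixZ y →
      OutputsRat (q n) (strWord M.numAux y ++ [nextSym M.numAux s]) (p.localProb y s)) ∧
    (∃ P : Polynomial ℕ, ∀ n, (θ n).length ≤ P.eval n) ∧
    (∃ P : Polynomial ℕ, ∀ n, M.ConstructsWithin (θ n) (q n) (P.eval n)) ∧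
    (∃ P : Polynomial ℕ, ∀ (n : ℕ) (y : List V) (s : Option V), y.length ≤ n →
      (q n).HaltsWithin (strWord M.numAux y ++ [nextSym M.numAux s]) (P.eval n))

end ParametricModel

/-- The weighted language `p` is efficiently computable with compact parameters. -/
def EfficientlyComputableWithCompactParameters {V : Type*} [Fintype V] (p : WeightedLanguage V) :
    Prop :=
  ∃ (M : ParametricModel V) (θ : ℕ → List Bool), M.EfficientlyComputes θ p

end SeqModel

end

open scoped NNReal

noncomputable section

namespace SeqModel

open Turing (Dir Tape ListBlank)

/-! By the chain rule, `p x` is the product of the local conditional probabilities of the symbols of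
`x`, followed by that of `$`. The partial products are `v t = Z(x₁…x_t) / Z`. They start at `1`, and
the last factor turns `Z(x) / Z` into `p̃(x) / Z`, because `Z(x) = p̃(x) + ∑ v, Z(xv)`
(`prefixZ_eq_add_sum`, `localProb_take`). So the new machine for length `n` asks `q n` the `n + 1`
queries along `x` and multiplies the fractions it answers.

A prefix of weight zero makes the next answers of `q n` meaningless. But then an earlier factor was
already zero. A flag records the first zero numerator, after which the contents of the accumulators
no longer matter and `0` is written at the end (`Accumulated`).

Since the parameters may depend on `n`, so may the machine, and no loop or clock is needed. A
straight-line program of polynomial length is unrolled into a transition table whose states are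
pairs of a time and finite control data (`compile`). Each query is simulated for exactly `T` steps,
where `T` is the time bound of `q n`. The parameters are the description of this machine, so the new
model only has to copy its input (`copyModel`).

Three bounds keep everything polynomial. The description of `q n` is written in polynomial time,
hence is short, and its unary coding then bounds the states to be simulated
(`length_le_of_right₀_eq`, `TM.tgt_lt_encode_length`). Each numeral answered by `q n` has at most `L
= n + 1 + T` bits, so all products are at most `2 ^ ((n + 1) * L)` and arithmetic modulo `2 ^ W`
with `W = (n + 1) * L + 1` loses nothing. Finally the table has one entry for each time, control
value and tuple of scanned symbols, with the numbers of tapes and symbols fixed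
(`compile_encode_length_le`). -/

/-! ### Tapes as functions on the integers, relative to the head -/

/-- The displacement of the head that a movement causes. -/
def moveOffset : Option Dir → ℤ
  | none => 0
  | some Dir.left => -1
  | some Dir.right => 1

@[simp] lemma moveOffset_none : moveOffset none = 0 := rfl

/-- Write a symbol under the head and move the head, for a tape given by its contents relative to
the head. -/
def writeMove {Γ : Type*} (f : ℤ → Γ) (a : Γ) (d : Option Dir) : ℤ → Γ :=
  fun i => Function.update f 0 a (i + moveOffset d)

/-- The tape that holds the word `w` from the head rightwards, and blanks elsewhere. -/
def wordTape {Γ : Type*} [Inhabited Γ] (w : List Γ) : ℤ → Γ :=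
  fun i => if 0 ≤ i then w.getI i.toNat else default

/-- The tape `f` with its head moved to position `j`. -/
def shift {Γ : Type*} (j : ℤ) (f : ℤ → Γ) : ℤ → Γ :=
  fun i => f (i + j)

section Tapes

variable {Γ : Type*}

@[simp] lemma shift_zero (f : ℤ → Γ) : shift 0 f = f := by
  funext i; simp [shift]

@[simp] lemma shift_shift (a b : ℤ) (f : ℤ → Γ) : shift a (shift b f) = shift (a + b) f := by
  funext i; simp [shift, add_assoc]

lemma shift_apply_zero (j : ℤ) (f : ℤ → Γ) : shift j f 0 = f j := by
  simp [shift]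

@[simp] lemma writeMove_head (f : ℤ → Γ) (d : Option Dir) :
    writeMove f (f 0) d = shift (moveOffset d) f := by
  funext i; simp [writeMove, shift]

/-- Separates the contents of a tape in fixed coordinates from the head position. Loops that write
while moving thereby get closed forms `shift j f`, in which only `f` is edited. -/
lemma writeMove_shift (j : ℤ) (f : ℤ → Γ) (a : Γ) (d : Option Dir) :
    writeMove (shift j f) a d = shift (moveOffset d + j) (Function.update f j a) := by
  funext i
  simp only [writeMove, shift, Function.update_apply]
  by_cases h : i + moveOffset d = 0
  · rw [if_pos h, if_pos (by omega)]
  · rw [if_neg h, if_neg (by omega), add_assoc]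

variable [Inhabited Γ]

lemma act_nth (T : Tape Γ) (a : Γ) (d : Option Dir) :
    (TM.act T a d).nth = writeMove T.nth a d := by
  have hw : (T.write a).nth = Function.update T.nth 0 a := by
    funext i; simp [Tape.write_nth, Function.update_apply]
  funext i
  rcases d with _ | _ | _
  · simp only [TM.act, writeMove, moveOffset, hw, add_zero]
  · simp only [TM.act, writeMove, moveOffset, Tape.move_left_nth, hw, sub_eq_add_neg]
  · simp only [TM.act, writeMove, moveOffset, Tape.move_right_nth, hw]

lemma mk₁_nth (w : List Γ) : (Tape.mk₁ w).nth = wordTape w := by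
  funext i
  rcases i with i | i
  · simp [Tape.mk₁, Tape.mk₂, wordTape]
  · simp [Tape.mk₁, Tape.mk₂, wordTape, Tape.mk', Tape.nth]

lemma right₀_eq_mk_iff (T : Tape Γ) (w : List Γ) :
    T.right₀ = ListBlank.mk w ↔ ∀ i : ℕ, T.nth i = w.getI i := by
  constructor
  · intro h i
    rw [← Tape.right₀_nth, h, ListBlank.nth_mk]
  · intro h
    refine ListBlank.ext fun i => ?_
    rw [Tape.right₀_nth, h, ListBlank.nth_mk]

@[simp] lemma wordTape_nil : wordTape ([] : List Γ) = fun _ => default := by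
  funext i; simp [wordTape]

lemma wordTape_natCast (w : List Γ) (i : ℕ) : wordTape w i = w.getI i := by
  simp [wordTape]

lemma wordTape_eq_default (w : List Γ) (i : ℤ) (h : (w.length : ℤ) ≤ i) :
    wordTape w i = default := by
  simp only [wordTape]
  split
  · exact List.getI_eq_default _ (by omega)
  · rfl

end Tapes

/-! ### Basic facts about runs -/

namespace TM

variable {k : ℕ} {Γ : Type*} [Inhabited Γ]

lemma run_succ (M : TM k Γ) (input : List Γ) (t : ℕ) :
    M.run input (t + 1) = M.step (M.run input t) :=
  Function.iterate_succ_apply' _ _ _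

lemma run_add_of_halts {M : TM k Γ} {input : List Γ} {t : ℕ} (h : M.HaltsWithin input t) (d : ℕ) :
    M.run input (t + d) = M.run input t := by
  induction d with
  | zero => rfl
  | succ d ih =>
    rw [← add_assoc, run_succ, ih, step]
    exact if_pos h

lemma run_eq_of_halts {M : TM k Γ} {input : List Γ} {t u : ℕ} (ht : M.HaltsWithin input t)
    (hu : M.HaltsWithin input u) : M.run input t = M.run input u := by
  rcases le_total t u with h | h
  · obtain ⟨d, rfl⟩ := Nat.exists_eq_add_of_le h
    exact (run_add_of_halts ht d).symm
  · obtain ⟨d, rfl⟩ := Nat.exists_eq_add_of_le h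
    exact run_add_of_halts hu d

lemma OutputsWithin.mono {M : TM k Γ} {input w : List Γ} {t u : ℕ}
    (h : M.OutputsWithin input w t) (htu : t ≤ u) : M.OutputsWithin input w u := by
  obtain ⟨d, rfl⟩ := Nat.exists_eq_add_of_le htu
  unfold OutputsWithin HaltsWithin
  rw [run_add_of_halts h.1 d]
  exact h

/-- Frees `step` from the order of the table, which for compiled machines comes from an arbitrary
enumeration of a finite set. -/
lemma step_eq_of_unique {M : TM k Γ} {c : Cfg k Γ} {r : Rule k Γ} (hc : c.state ≠ 1)
    (hmem : r ∈ M.rules) (hr : r.src = c.state ∧ r.read = fun i => (c.tape i).head)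
    (huniq : ∀ r' ∈ M.rules, (r'.src = c.state ∧ r'.read = fun i => (c.tape i).head) → r' = r) :
    M.step c = ⟨r.tgt, fun i => act (c.tape i) (r.write i) (r.move i)⟩ := by
  rw [step, if_neg hc]
  split
  · rename_i hf
    rw [List.find?_eq_none] at hf
    have := hf _ hmem
    simp [hr] at this
  · rename_i r' hf
    have := List.find?_some hf
    rw [huniq r' (List.mem_of_find?_eq_some hf) (by simpa using this)]

lemma init_nth (input : List Γ) (j : Fin (k + 1)) :
    ((init k input).tape j).nth = wordTape (if j = 0 then input else []) := by
  by_cases h : j = 0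
  · simp [init, h, mk₁_nth]
  · simp only [init, h, if_false, mk₁_nth]

/-- A machine can only have written near its heads. -/
lemma run_nth_eq_default (M : TM k Γ) (input : List Γ) (t : ℕ) (j : Fin (k + 1)) (i : ℤ)
    (h : (input.length : ℤ) + t < |i|) : ((M.run input t).tape j).nth i = default := by
  induction t generalizing i with
  | zero =>
    show ((init k input).tape j).nth i = default
    rw [init_nth]
    rcases le_or_gt 0 i with hi | hi
    · rw [abs_of_nonneg hi] at h
      refine wordTape_eq_default _ _ ?_
      split
      · push_cast at h; omega
      · simpa using hi
    · simp [wordTape, hi]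
  | succ t ih =>
    rw [run_succ, step]
    have h0 : ((M.run input t).tape j).nth i = default :=
      ih _ (by push_cast at h; omega)
    split
    · exact h0
    split
    · exact h0
    · rename_i r _
      simp only [act_nth, writeMove]
      have hoff : |moveOffset (r.move j)| ≤ 1 := by
        rcases r.move j with _ | _ | _ <;> simp [moveOffset]
      have h1 : |i| ≤ |i + moveOffset (r.move j)| + |moveOffset (r.move j)| := by
        have := abs_sub (i + moveOffset (r.move j)) (moveOffset (r.move j))
        simpa using this
      have hne : i + moveOffset (r.move j) ≠ 0 := by
        intro h2
        rw [h2] at h1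
        simp only [abs_zero] at h1
        push_cast at h; omega
      rw [Function.update_of_ne hne]
      exact ih _ (by push_cast at h; omega)

/-- A longer word would put a nonblank symbol on a cell too far away to have been reached. This
bounds both the description of `q n` and the numerals that `q n` outputs. -/
lemma length_le_of_right₀_eq {M : TM k Γ} {input w : List Γ} {t : ℕ}
    (h : ((M.run input t).tape 0).right₀ = ListBlank.mk w) (hw : ∀ a ∈ w, a ≠ default) :
    w.length ≤ input.length + t + 1 := by
  by_contra! hlt
  rw [right₀_eq_mk_iff] at h
  have h1 := h (input.length + t + 1)
  rw [run_nth_eq_default _ _ _ _ _ (by rw [abs_of_nonneg (by positivity)]; push_cast; omega),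
    List.getI_eq_getElem _ hlt] at h1
  exact hw _ (List.getElem_mem hlt) h1.symm

end TM

/-! ### Straight-line programs and their compilation -/

/-- An instruction of a straight-line program with control data `σ` and tapes `ι`: from the control
data and the scanned symbols it determines the new control data and, for each tape, the symbol to
write and the head movement. -/
abbrev Instr (σ ι Γ : Type*) := σ → (ι → Γ) → σ × (ι → Γ × Option Dir)

section Program

variable {σ ι Γ : Type*}

/-- The effect of an instruction. -/
def Instr.exec (a : Instr σ ι Γ) (s : σ × (ι → ℤ → Γ)) : σ × (ι → ℤ → Γ) :=
  ((a s.1 fun i => s.2 i 0).1,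
    fun i => writeMove (s.2 i) ((a s.1 fun i => s.2 i 0).2 i).1 ((a s.1 fun i => s.2 i 0).2 i).2)

/-- The effect of a straight-line program. -/
def execAll (p : List (Instr σ ι Γ)) (s : σ × (ι → ℤ → Γ)) : σ × (ι → ℤ → Γ) :=
  p.foldl (fun s a => a.exec s) s

@[simp] lemma execAll_nil (s : σ × (ι → ℤ → Γ)) : execAll [] s = s := rfl

@[simp] lemma execAll_cons (a : Instr σ ι Γ) (p : List (Instr σ ι Γ)) (s : σ × (ι → ℤ → Γ)) :
    execAll (a :: p) s = execAll p (a.exec s) := rfl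

@[simp] lemma execAll_append (p p' : List (Instr σ ι Γ)) (s : σ × (ι → ℤ → Γ)) :
    execAll (p ++ p') s = execAll p' (execAll p s) :=
  List.foldl_append

@[simp] lemma execAll_replicate (n : ℕ) (a : Instr σ ι Γ) (s : σ × (ι → ℤ → Γ)) :
    execAll (List.replicate n a) s = a.exec^[n] s := by
  induction n generalizing s with
  | zero => rfl
  | succ n ih => rw [List.replicate_succ, execAll_cons, ih, Function.iterate_succ_apply]

@[simp] lemma execAll_flatten_replicate (n : ℕ) (p : List (Instr σ ι Γ)) (s : σ × (ι → ℤ → Γ)) :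
    execAll (List.replicate n p).flatten s = (execAll p)^[n] s := by
  induction n generalizing s with
  | zero => rfl
  | succ n ih =>
    rw [List.replicate_succ, List.flatten_cons, execAll_append, ih, Function.iterate_succ_apply]

/-- The number of the machine state at time `i` with control data number `c`, in the machine
compiled from a program of length `T`. -/
def stateNum (T m i c : ℕ) : ℕ :=
  if i = 0 then 0 else if i = T then 1 else 2 + (i * m + c)

/-- Quotient and remainder by `m` recover the time and the control data. At time `0` the control
data are lost because the initial state is the number `0`; hence the disjunction. -/
lemma stateNum_inj {T m i c i' c' : ℕ} (hi : i < T) (hi' : i' < T) (hc : c < m) (hc' : c' < m)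
    (h : stateNum T m i c = stateNum T m i' c') : i = i' ∧ (i = 0 ∨ c = c') := by
  simp only [stateNum, hi.ne, hi'.ne, if_false] at h
  rcases Nat.eq_zero_or_pos i with rfl | h0 <;> rcases Nat.eq_zero_or_pos i' with rfl | h0'
  · simp
  · simp only [h0'.ne', if_false, if_true] at h
    omega
  · simp only [h0.ne', if_false, if_true] at h
    omega
  · simp only [h0.ne', h0'.ne', if_false, Nat.add_left_cancel_iff] at h
    have hm : 0 < m := by omega
    have h1 : (c + m * i) / m = (c' + m * i') / m := by
      rw [mul_comm m i, mul_comm m i', add_comm c, add_comm c', h]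
    rw [Nat.add_mul_div_left _ _ hm, Nat.add_mul_div_left _ _ hm, Nat.div_eq_of_lt hc,
      Nat.div_eq_of_lt hc'] at h1
    have h2 : i = i' := by omega
    subst h2
    exact ⟨rfl, Or.inr (by omega)⟩

lemma stateNum_ne_one {T m i c : ℕ} (hi : i < T) : stateNum T m i c ≠ 1 := by
  simp only [stateNum, hi.ne, if_false]
  split <;> omega

lemma stateNum_le {T m i c : ℕ} (hi : i ≤ T) (hc : c < m) :
    stateNum T m i c ≤ 2 + (T + 1) * m := by
  unfold stateNum
  split
  · omega
  split
  · omega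
  · have := Nat.mul_le_mul_right m hi
    have h2 : (T + 1) * m = T * m + m := by ring
    omega

variable [Fintype σ] {K : ℕ}

/-- The table entry that executes an instruction at time `x.1`, with control data `x.2.1` (the
initial control data `s₀` at time `0`) and scanned symbols `x.2.2`. -/
def compileRule (e : ι ≃ Fin (K + 1)) (p : List (Instr σ ι Γ)) (s₀ : σ)
    (x : Fin p.length × σ × (Fin (K + 1) → Γ)) : Rule K Γ :=
  let c := if (x.1 : ℕ) = 0 then s₀ else x.2.1
  let r := p[x.1] c (fun i => x.2.2 (e i))
  { src := stateNum p.length (Fintype.card σ) x.1 (Fintype.equivFin σ c)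
    read := x.2.2
    tgt := stateNum p.length (Fintype.card σ) (x.1 + 1) (Fintype.equivFin σ r.1)
    write := fun j => (r.2 (e.symm j)).1
    move := fun j => (r.2 (e.symm j)).2 }

/-- The Turing machine that runs a straight-line program. -/
def compile [Fintype Γ] (e : ι ≃ Fin (K + 1)) (p : List (Instr σ ι Γ)) (s₀ : σ) : TM K Γ :=
  ⟨(Finset.univ : Finset (Fin p.length × σ × (Fin (K + 1) → Γ))).toList.map (compileRule e p s₀)⟩

/-- The tapes at the beginning of a run. -/
def startTapes [Inhabited Γ] (e : ι ≃ Fin (K + 1)) (input : List Γ) : ι → ℤ → Γ :=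
  fun i => wordTape (if e i = 0 then input else [])

/-- The state carries the time, so exactly one instruction applies at each step and the machine
follows the program instruction by instruction. -/
lemma compile_run [Fintype Γ] [Inhabited Γ] (e : ι ≃ Fin (K + 1)) (p : List (Instr σ ι Γ)) (s₀ : σ)
    (input : List Γ) (t : ℕ) (ht : t ≤ p.length) :
    ((compile e p s₀).run input t).state = stateNum p.length (Fintype.card σ) t
        (Fintype.equivFin σ (execAll (p.take t) (s₀, startTapes e input)).1) ∧
      ∀ i, (((compile e p s₀).run input t).tape (e i)).nth =
        (execAll (p.take t) (s₀, startTapes e input)).2 i := by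
  induction t with
  | zero =>
    refine ⟨by simp [TM.run, TM.init, stateNum], fun i => ?_⟩
    exact TM.init_nth _ _
  | succ t ih =>
    obtain ⟨ih1, ih2⟩ := ih (by omega)
    have hlt : t < p.length := by omega
    set c := (compile e p s₀).run input t with hc
    set s := execAll (p.take t) (s₀, startTapes e input) with hs
    have hs' : execAll (p.take (t + 1)) (s₀, startTapes e input) = p[t].exec s := by
      rw [← List.take_append_getElem hlt, execAll_append]; rfl
    have h0 : t = 0 → s.1 = s₀ := by rintro rfl; simp [hs]
    have hif : (if t = 0 then s₀ else s.1) = s.1 := by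
      split
      · rename_i h; exact (h0 h).symm
      · rfl
    have hhead : (fun i => (c.tape (e i)).head) = fun i => s.2 i 0 := by
      funext i; rw [← ih2]; rfl
    set x : Fin p.length × σ × (Fin (K + 1) → Γ) := (⟨t, hlt⟩, s.1, fun j => (c.tape j).head)
      with hx
    have hmatch : (compileRule e p s₀ x).src = c.state ∧
        (compileRule e p s₀ x).read = fun j => (c.tape j).head := by
      refine ⟨?_, rfl⟩
      rw [ih1]; simp only [compileRule, hx, hif]
    have hmem : compileRule e p s₀ x ∈ (compile e p s₀).rules :=
      List.mem_map.2 ⟨x, by simp, rfl⟩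
    have huniq : ∀ r ∈ (compile e p s₀).rules, (r.src = c.state ∧
        r.read = fun i => (c.tape i).head) → r = compileRule e p s₀ x := by
      intro r hr hr'
      obtain ⟨⟨⟨y1, hy1⟩, y2, y3⟩, -, rfl⟩ := List.mem_map.1 hr
      obtain ⟨h1, h2⟩ := hr'
      rw [← hmatch.1] at h1
      obtain ⟨h3, h4⟩ := stateNum_inj hy1 x.1.2 (Fin.is_lt _) (Fin.is_lt _) h1
      obtain rfl : y1 = t := h3
      obtain rfl : y3 = fun j => (c.tape j).head := h2
      -- At time `0` the table has an entry for every control value, all with source state `0`. They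
      -- coincide as entries because `compileRule` substitutes `s₀` there.
      have h5 : (if y1 = 0 then s₀ else y2) = if y1 = 0 then s₀ else s.1 := by
        rcases h4 with h4 | h4
        · rw [if_pos h4, if_pos h4]
        · exact (Fintype.equivFin σ).injective (Fin.ext h4)
      rw [hx]
      simp only [compileRule, h5]
    rw [hs', TM.run_succ, ← hc,
      TM.step_eq_of_unique (by rw [ih1]; exact stateNum_ne_one hlt) hmem hmatch huniq]
    have hr : (compileRule e p s₀ x).tgt = stateNum p.length (Fintype.card σ) (t + 1)
        (Fintype.equivFin σ (p[t].exec s).1) := by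
      simp only [compileRule, hx, hif, hhead, Instr.exec]
      rfl
    refine ⟨hr, fun i => ?_⟩
    simp only [act_nth, ih2, compileRule, hx, hif, hhead, Instr.exec, Equiv.symm_apply_apply]
    rfl

/-- The compiled machine halts after as many steps as the program has instructions, with the
tapes that the program produces. -/
lemma compile_outputsWithin [Fintype Γ] [Inhabited Γ] (e : ι ≃ Fin (K + 1))
    (p : List (Instr σ ι Γ)) (hp : p ≠ []) (s₀ : σ) (input w : List Γ)
    (h : ∀ i : ℕ, (execAll p (s₀, startTapes e input)).2 (e.symm 0) i = w.getI i) :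
    (compile e p s₀).OutputsWithin input w p.length := by
  obtain ⟨h1, h2⟩ := compile_run e p s₀ input p.length le_rfl
  rw [List.take_length] at h1 h2
  refine ⟨?_, ?_⟩
  · rw [TM.HaltsWithin, h1, stateNum, if_neg (by simpa using hp), if_pos rfl]
  · rw [right₀_eq_mk_iff]
    intro i
    rw [← h, ← h2, Equiv.apply_symm_apply]

end Program

/-! ### Lengths of descriptions -/

section Encode

variable {V : Type*} [Fintype V] {g k : ℕ}

lemma Sym.code_lt (s : Sym V g) : s.code < 5 + Fintype.card V + g := by
  rcases s with _ | (_ | _) | _ | _ | v | i <;> simp only [Sym.code] <;> omega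

lemma Sym.code_injective : Function.Injective (Sym.code : Sym V g → ℕ) := by
  intro s s' h
  rcases s with _ | (_ | _) | _ | _ | v | i <;> rcases s' with _ | (_ | _) | _ | _ | v' | i' <;>
    simp only [Sym.code] at h <;> first | rfl | omega | skip
  · exact congrArg _ ((Fintype.equivFin V).injective (Fin.ext (by omega)))
  · exact congrArg _ (Fin.ext (by omega))

instance : Finite (Sym V g) :=
  Finite.of_injective (fun s : Sym V g => (⟨s.code, s.code_lt⟩ : Fin (5 + Fintype.card V + g)))
    fun _ _ h => Sym.code_injective (Fin.mk.inj h)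

instance : Fintype (Sym V g) := Fintype.ofFinite _

lemma encNat_length (n : ℕ) : (encNat n).length = n + 1 := by
  simp [encNat]

lemma encMove_length_le (d : Option Dir) : (encMove d).length ≤ 3 := by
  rcases d with _ | _ | _ <;> simp [encMove, encNat]

lemma length_flatten_ofFn_le {α : Type*} {n B : ℕ} (f : Fin n → List α)
    (h : ∀ i, (f i).length ≤ B) : (List.ofFn f).flatten.length ≤ n * B := by
  rw [List.length_flatten, List.map_ofFn, List.sum_ofFn]
  simpa using Finset.sum_le_sum fun i (_ : i ∈ Finset.univ) => h i

lemma Rule.encode_length_le (r : Rule k (Sym V g)) :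
    r.encode.length ≤ r.src + r.tgt + (2 + 2 * ((k + 1) * (8 + Fintype.card V + g))) := by
  have h1 := length_flatten_ofFn_le (B := 8 + Fintype.card V + g)
    (fun i => encNat (r.read i).code) fun i => by
      have := (r.read i).code_lt
      rw [encNat_length]; omega
  have h2 := length_flatten_ofFn_le (B := 8 + Fintype.card V + g)
    (fun i => encNat (r.write i).code ++ encMove (r.move i)) fun i => by
      have := (r.write i).code_lt
      have := encMove_length_le (r.move i)
      rw [List.length_append, encNat_length]; omega
  simp only [Rule.encode, List.length_append, encNat_length]
  omega

lemma Rule.tgt_lt_encode_length (r : Rule k (Sym V g)) : r.tgt < r.encode.length := by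
  simp only [Rule.encode, List.length_append, encNat_length]
  omega

/-- State numbers are coded in unary, so a short description only mentions small states. This is why
`Fin (q.encode.length + 1)` suffices to simulate `q`. -/
lemma TM.tgt_lt_encode_length (M : TM k (Sym V g)) {r : Rule k (Sym V g)} (hr : r ∈ M.rules) :
    r.tgt < M.encode.length := by
  refine r.tgt_lt_encode_length.trans_le ?_
  rw [TM.encode, List.length_flatMap]
  exact List.single_le_sum (by simp) _ (List.mem_map.2 ⟨r, hr, rfl⟩)

/-- The number of table entries times a bound for one entry. The unary coding costs as much as the
largest state number, which is itself linear in the program length. -/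
lemma compile_encode_length_le {σ ι : Type*} [Fintype σ] (e : ι ≃ Fin (k + 1))
    (p : List (Instr σ ι (Sym V g))) (s₀ : σ) :
    (compile e p s₀).encode.length ≤
      (p.length * (Fintype.card σ * Fintype.card (Sym V g) ^ (k + 1))) *
        (2 * (2 + (p.length + 1) * Fintype.card σ) +
          (2 + 2 * ((k + 1) * (8 + Fintype.card V + g)))) := by
  classical
  have hrule : ∀ r ∈ (compile e p s₀).rules, r.encode.length ≤
      2 * (2 + (p.length + 1) * Fintype.card σ) +
          (2 + 2 * ((k + 1) * (8 + Fintype.card V + g))) := by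
    intro r hr
    obtain ⟨x, -, rfl⟩ := List.mem_map.1 hr
    refine (Rule.encode_length_le _).trans ?_
    have h1 : (compileRule e p s₀ x).src ≤ 2 + (p.length + 1) * Fintype.card σ :=
      stateNum_le x.1.2.le (Fin.is_lt _)
    have h2 : (compileRule e p s₀ x).tgt ≤ 2 + (p.length + 1) * Fintype.card σ :=
      stateNum_le x.1.2 (Fin.is_lt _)
    omega
  have hlen : (compile e p s₀).rules.length =
      p.length * (Fintype.card σ * Fintype.card (Sym V g) ^ (k + 1)) := by
    simp [compile]
  rw [TM.encode, List.length_flatMap, ← hlen]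
  refine (List.sum_le_card_nsmul _ (2 * (2 + (p.length + 1) * Fintype.card σ) +
          (2 + 2 * ((k + 1) * (8 + Fintype.card V + g)))) ?_).trans (by simp)
  intro l hl
  obtain ⟨r, hr, rfl⟩ := List.mem_map.1 hl
  exact hrule r hr

end Encode

/-! ### The program that multiplies local conditional probabilities -/

/-- What a pass over the work tapes does. -/
inductive Op where
  | skip
  | add (b : Bool)
  | flush

instance : Finite Op :=
  Finite.of_injective (β := Option (Option Bool))
    (fun
      | .skip => none
      | .add b => some (some b)
      | .flush => some none)
    (by rintro (_ | _ | _) (_ | _ | _) h <;> simp_all)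

/-- The finite control data of the program, besides the state of the simulated machine. -/
structure Ctl where
  zero : Bool
  seen : Bool
  mode : Bool
  op : Op
  carry : Fin 3

instance : Finite Ctl :=
  Finite.of_injective (fun c : Ctl => (c.zero, c.seen, c.mode, c.op, c.carry))
    (by rintro ⟨⟩ ⟨⟩ h; simpa using h)

instance : Fintype Ctl := Fintype.ofFinite _

/-- The tapes of the program: the input and output tape, a tape for intermediate results, the
accumulated denominator `acc false` and numerator `acc true`, and the tapes of the simulated
machine. -/
inductive TapeName (k : ℕ) where
  | inp
  | res
  | acc (b : Bool)
  | sim (i : Fin (k + 1))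

instance (k : ℕ) : DecidableEq (TapeName k) := Classical.decEq _

/-- The tapes as a sum type. -/
def tapeNameEquiv (k : ℕ) : TapeName k ≃ (Unit ⊕ Unit) ⊕ (Bool ⊕ Fin (k + 1)) where
  toFun
    | .inp => .inl (.inl ())
    | .res => .inl (.inr ())
    | .acc b => .inr (.inl b)
    | .sim i => .inr (.inr i)
  invFun
    | .inl (.inl _) => .inp
    | .inl (.inr _) => .res
    | .inr (.inl b) => .acc b
    | .inr (.inr i) => .sim i
  left_inv := by rintro (_ | _ | _ | _) <;> rfl
  right_inv := by rintro ((_ | _) | (_ | _)) <;> rfl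

instance (k : ℕ) : Fintype (TapeName k) := Fintype.ofEquiv _ (tapeNameEquiv k).symm

lemma card_tapeName (k : ℕ) : Fintype.card (TapeName k) = (k + 4) + 1 := by
  rw [Fintype.card_congr (tapeNameEquiv k)]
  simp
  omega

lemma exists_tapeName_equiv (k : ℕ) :
    ∃ e : TapeName k ≃ Fin ((k + 4) + 1), e TapeName.inp = 0 := by
  let e := Fintype.equivFinOfCardEq (card_tapeName k)
  exact ⟨e.trans (Equiv.swap (e TapeName.inp) 0), by simp⟩

section Moves

variable {σ ι Γ : Type*}

/-- The instruction that only moves heads. -/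
def moveHeads (d : ι → Option Dir) : Instr σ ι Γ :=
  fun s ρ => (s, fun i => (ρ i, d i))

lemma moveHeads_iterate (d : ι → Option Dir) (n : ℕ) (s : σ × (ι → ℤ → Γ)) :
    (moveHeads d).exec^[n] s = (s.1, fun i => shift (n * moveOffset (d i)) (s.2 i)) := by
  induction n with
  | zero => simp
  | succ n ih =>
    rw [Function.iterate_succ_apply', ih]
    simp only [Instr.exec, moveHeads, writeMove_head, shift_shift]
    congr 2
    funext i
    congr 1
    push_cast
    ring

end Moves

/-! ### Numbers in binary on tapes -/

section Val

variable {V : Type*} {g : ℕ}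

/-- Whether a tape symbol is the bit `1`. -/
def Sym.isOne : Sym V g → Bool
  | .bit b => b
  | _ => false

/-- The number on the first `W` cells of a tape, where all symbols but the bit `1` count as `0`. -/
def tapeVal (W : ℕ) (f : ℤ → Sym V g) : ℕ :=
  ∑ i ∈ Finset.range W, (f i).isOne.toNat * 2 ^ i

lemma tapeVal_succ (W : ℕ) (f : ℤ → Sym V g) :
    tapeVal (W + 1) f = tapeVal W f + (f W).isOne.toNat * 2 ^ W :=
  Finset.sum_range_succ _ _

lemma tapeVal_congr {W : ℕ} {f f' : ℤ → Sym V g} (h : ∀ i : ℕ, i < W → (f i).isOne = (f' i).isOne) :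
    tapeVal W f = tapeVal W f' :=
  Finset.sum_congr rfl fun i hi => by rw [h i (Finset.mem_range.1 hi)]

lemma tapeVal_update (W : ℕ) (f : ℤ → Sym V g) (a : Sym V g) :
    tapeVal W (Function.update f W a) = tapeVal W f := by
  refine tapeVal_congr fun i hi => ?_
  rw [Function.update_of_ne (by simpa using hi.ne)]

lemma tapeVal_succ_update (W : ℕ) (f : ℤ → Sym V g) (a : Sym V g) :
    tapeVal (W + 1) (Function.update f W a) = tapeVal W f + a.isOne.toNat * 2 ^ W := by
  rw [tapeVal_succ, tapeVal_update, Function.update_self]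

lemma binVal_append_singleton (w : List Bool) (b : Bool) :
    binVal (w ++ [b]) = binVal w + b.toNat * 2 ^ w.length := by
  simp [binVal, Nat.ofDigits_append, mul_comm]

lemma binVal_cons (b : Bool) (w : List Bool) : binVal (b :: w) = b.toNat + 2 * binVal w := by
  simp [binVal, Nat.ofDigits_cons]

lemma binVal_lt (w : List Bool) : binVal w < 2 ^ w.length := by
  induction w with
  | nil => simp [binVal]
  | cons b w ih =>
    rw [binVal_cons, List.length_cons, pow_succ]
    have := Bool.toNat_le b
    omega

lemma binVal_eq_zero_iff (w : List Bool) : binVal w = 0 ↔ w.any id = false := by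
  induction w with
  | nil => simp [binVal]
  | cons b w ih =>
    rw [binVal_cons, List.any_cons, Bool.or_eq_false_iff, ← ih]
    cases b <;> simp

lemma binVal_map_range (W : ℕ) (f : ℤ → Sym V g) :
    binVal ((List.range W).map fun i : ℕ => (f i).isOne) = tapeVal W f := by
  induction W with
  | zero => simp [binVal, tapeVal]
  | succ W ih =>
    rw [List.range_succ, List.map_append, List.map_singleton, binVal_append_singleton, ih,
      tapeVal_succ]
    simp

lemma tapeVal_lt (W : ℕ) (f : ℤ → Sym V g) : tapeVal W f < 2 ^ W := by
  rw [← binVal_map_range]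
  simpa using binVal_lt ((List.range W).map fun i : ℕ => (f i).isOne)

end Val

/-! ### Instructions for loading, simulating and digitwise arithmetic -/

section Instructions

variable {V : Type*} {g k m : ℕ}

/-- A configuration of the program. -/
abbrev Store (V : Type*) (g k m : ℕ) := (Fin m × Ctl) × (TapeName k → ℤ → Sym V g)

/-- An instruction of the program. -/
abbrev MulInstr (V : Type*) (g k m : ℕ) := Instr (Fin m × Ctl) (TapeName k) (Sym V g)

/-- A scanned input symbol as the next symbol: letters stay, and the blank behind the input
becomes the end-of-string symbol. -/
def Sym.asNext : Sym V g → Sym V g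
  | .letter v => .letter v
  | _ => .eos

/-- Copy one symbol from the input tape to the first simulated tape. -/
def copyIn : MulInstr V g k m := fun s ρ =>
  (s, fun
    | .inp => (ρ .inp, some Dir.right)
    | .sim i => if i = 0 then ((ρ .inp).asNext, some Dir.right) else (ρ (.sim i), none)
    | i => (ρ i, none))

lemma copyIn_iterate (j : ℕ) (s : Store V g k m) :
    copyIn.exec^[j] s = (s.1, fun
      | .inp => shift j (s.2 .inp)
      | .sim i => if i = 0 then shift j (fun p => if 0 ≤ p ∧ p < j then (s.2 .inp p).asNext
          else s.2 (.sim 0) p) else s.2 (.sim i)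
      | i => s.2 i) := by
  induction j with
  | zero =>
    refine Prod.ext rfl ?_
    funext i
    cases i with
    | sim i =>
      by_cases hi : i = 0
      · subst hi
        funext p
        have : ¬ (0 ≤ p ∧ p < 0) := by omega
        simp [this]
      · simp [hi]
    | _ => simp
  | succ j ih =>
    rw [Function.iterate_succ_apply', ih]
    refine Prod.ext rfl ?_
    funext i
    cases i with
    | inp =>
      simp only [Instr.exec, copyIn, writeMove_head, shift_shift, moveOffset]
      push_cast
      rw [add_comm]
    | sim i =>
      by_cases hi : i = 0
      · subst hi
        simp only [Instr.exec, copyIn, if_true, shift_apply_zero, writeMove_shift, moveOffset]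
        push_cast
        rw [add_comm (1 : ℤ)]
        congr 1
        funext p
        rw [Function.update_apply]
        by_cases hp : p = j
        · subst hp
          rw [if_pos rfl, if_pos (by omega)]
        · rw [if_neg hp]
          by_cases hp' : 0 ≤ p ∧ p < j
          · rw [if_pos hp', if_pos (by omega)]
          · rw [if_neg hp', if_neg (by omega)]
      · simp [Instr.exec, copyIn, hi]
    | _ => simp [Instr.exec, copyIn]

/-- The head movements that undo those of `copyIn`. -/
def copyBack : TapeName k → Option Dir
  | .inp => some Dir.left
  | .sim i => if i = 0 then some Dir.left else none
  | _ => none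

/-- Copy `j` symbols of the input to the first simulated tape. -/
def load (j : ℕ) : List (MulInstr V g k m) :=
  List.replicate j copyIn ++ List.replicate j (moveHeads copyBack)

lemma execAll_load (j : ℕ) (s : Store V g k m) :
    execAll (load j) s = (s.1, Function.update s.2 (.sim 0) fun p =>
      if 0 ≤ p ∧ p < j then (s.2 .inp p).asNext else s.2 (.sim 0) p) := by
  rw [load, execAll_append, execAll_replicate, execAll_replicate, copyIn_iterate,
    moveHeads_iterate]
  refine Prod.ext rfl ?_
  funext i
  cases i with
  | sim i =>
    by_cases hi : i = 0
    · subst hi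
      simp [copyBack, moveOffset]
    · simp [copyBack, moveOffset, hi]
  | _ => simp [copyBack, moveOffset]

open Classical in
/-- One step of the machine `q` on the simulated tapes. -/
def simulate (q : TM k (Sym V g)) : MulInstr V g k m := fun s ρ =>
  if (s.1 : ℕ) = 1 then (s, fun i => (ρ i, none))
  else
    match q.rules.find? (fun r => decide (r.src = (s.1 : ℕ) ∧ r.read = fun i => ρ (.sim i))) with
    | none => (s, fun i => (ρ i, none))
    | some r => ((if h : r.tgt < m then ⟨r.tgt, h⟩ else s.1, s.2), fun
        | .sim i => (r.write i, r.move i)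
        | i => (ρ i, none))

/-- The program configuration `s` represents the configuration `c` of the simulated machine. -/
def Represents (s : Store V g k m) (c : Cfg k (Sym V g)) : Prop :=
  (s.1.1 : ℕ) = c.state ∧ ∀ i, s.2 (.sim i) = (c.tape i).nth

lemma Represents.simulate {q : TM k (Sym V g)} (hq : ∀ r ∈ q.rules, r.tgt < m)
    {s : Store V g k m} {c : Cfg k (Sym V g)} (h : Represents s c) :
    Represents ((simulate q).exec s) (q.step c) ∧ ((simulate q).exec s).1.2 = s.1.2 ∧
      ∀ i, (∀ j, i ≠ .sim j) → ((simulate q).exec s).2 i = s.2 i := by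
  obtain ⟨h1, h2⟩ := h
  have hhead : (fun i => s.2 (.sim i) 0) = fun i => (c.tape i).head := by
    funext i; rw [h2]; rfl
  unfold Represents
  by_cases hc : c.state = 1
  · have he : (SeqModel.simulate q).exec s = s := by
      simp [Instr.exec, SeqModel.simulate, h1, hc]
    rw [he, TM.step, if_pos hc]
    exact ⟨⟨h1, h2⟩, rfl, fun _ _ => rfl⟩
  rw [TM.step, if_neg hc]
  split
  · rename_i hf
    have he : (SeqModel.simulate q).exec s = s := by
      rw [← h1, ← hhead] at hf
      simp only [Instr.exec, SeqModel.simulate]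
      rw [hf]
      simp
    rw [he]
    exact ⟨⟨h1, h2⟩, rfl, fun _ _ => rfl⟩
  · rename_i r hf
    have hr := hq r (List.mem_of_find?_eq_some hf)
    rw [← h1, ← hhead] at hf
    simp only [Instr.exec, SeqModel.simulate]
    rw [hf, h1, if_neg hc]
    refine ⟨⟨by simp [hr], fun i => ?_⟩, rfl, fun i hi => ?_⟩
    · simp [act_nth, h2]
    · cases i with
      | sim j => exact absurd rfl (hi j)
      | _ => simp

/-- `hq` ensures that the control data can hold every state reached; the remaining control data and
tapes stay intact. -/
lemma simulate_iterate {q : TM k (Sym V g)} (hq : ∀ r ∈ q.rules, r.tgt < m) (w : List (Sym V g))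
    {s : Store V g k m} (h : Represents s (TM.init k w)) (T : ℕ) :
    Represents ((simulate q).exec^[T] s) (q.run w T) ∧ ((simulate q).exec^[T] s).1.2 = s.1.2 ∧
      ∀ i, (∀ j, i ≠ .sim j) → ((simulate q).exec^[T] s).2 i = s.2 i := by
  induction T with
  | zero => exact ⟨h, rfl, fun _ _ => rfl⟩
  | succ T ih =>
    obtain ⟨h1, h2, h3⟩ := ih
    obtain ⟨h4, h5, h6⟩ := h1.simulate hq
    rw [Function.iterate_succ_apply', TM.run_succ]
    exact ⟨h4, h5.trans h2, fun i hi => (h6 i hi).trans (h3 i hi)⟩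

/-- The operation that a symbol of the output of the simulated machine calls for. -/
def Sym.toOp : Sym V g → Op
  | .bit b => .add b
  | .slash => .flush
  | _ => .skip

/-- The accumulator in use after a symbol of the output of the simulated machine. -/
def Sym.nextMode : Sym V g → Bool → Bool
  | .slash, b => !b
  | _, b => b

/-- Read a symbol of the output of the simulated machine. -/
def fetch : MulInstr V g k m := fun s ρ =>
  ((s.1, { s.2 with
      op := (ρ (.sim 0)).toOp
      carry := 0
      mode := (ρ (.sim 0)).nextMode s.2.mode
      seen := s.2.seen || (s.2.mode && (ρ (.sim 0)).isOne) }),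
    fun
    | .sim i => (ρ (.sim i), if i = 0 then some Dir.left else none)
    | i => (ρ i, none))

/-- One digit of a pass: `add b` doubles the number on `res` and adds `b` times the current
accumulator, and `flush` moves the number on `res` to the other accumulator. -/
def sweep : MulInstr V g k m := fun s ρ =>
  match s.2.op with
  | .skip => (s, fun
      | .inp => (ρ .inp, none)
      | .sim i => (ρ (.sim i), none)
      | i => (ρ i, some Dir.right))
  | .add b =>
    let c := (s.2.carry : ℕ) + (b && (ρ (.acc s.2.mode)).isOne).toNat
    ((s.1, { s.2 with carry := Fin.ofNat 3 (c / 2 + (ρ .res).isOne.toNat) }), fun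
      | .inp => (ρ .inp, none)
      | .sim i => (ρ (.sim i), none)
      | .res => (.bit (decide (c % 2 = 1)), some Dir.right)
      | .acc b => (ρ (.acc b), some Dir.right))
  | .flush => (s, fun
      | .inp => (ρ .inp, none)
      | .sim i => (ρ (.sim i), none)
      | .res => (.bit false, some Dir.right)
      | .acc b => (if b = s.2.mode then ρ (.acc b) else ρ .res, some Dir.right))

/-- Replace the contents of the work tapes. -/
def withWork (τ : TapeName k → ℤ → Sym V g) (r : ℤ → Sym V g) (a : Bool → ℤ → Sym V g) :
    TapeName k → ℤ → Sym V g
  | .inp => τ .inp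
  | .res => r
  | .acc b => a b
  | .sim i => τ (.sim i)

lemma sweep_iterate_skip {s : Store V g k m} (h : s.1.2.op = .skip) (j : ℕ) :
    sweep.exec^[j] s = (s.1, withWork s.2 (shift j (s.2 .res)) fun b => shift j (s.2 (.acc b))) := by
  induction j with
  | zero =>
    refine Prod.ext rfl ?_
    funext i; cases i <;> simp [withWork]
  | succ j ih =>
    rw [Function.iterate_succ_apply', ih]
    simp only [Instr.exec, sweep, h]
    refine Prod.ext rfl ?_
    funext i
    cases i <;> simp [withWork, moveOffset, add_comm]

/-- Only the values of the new tapes matter. The clause on `r` beyond `j` says that digits not yet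
visited are still the old ones, which the induction needs. -/
lemma sweep_iterate_flush {s : Store V g k m} (h : s.1.2.op = .flush) (j : ℕ) :
    ∃ (r a : ℤ → Sym V g), sweep.exec^[j] s = (s.1, withWork s.2 (shift j r)
        fun b => shift j (if b = s.1.2.mode then s.2 (.acc b) else a)) ∧
      (∀ i : ℤ, j ≤ i → r i = s.2 .res i) ∧ tapeVal j r = 0 ∧
      tapeVal j a = tapeVal j (s.2 .res) := by
  induction j with
  | zero =>
    refine ⟨s.2 .res, s.2 (.acc !s.1.2.mode), Prod.ext rfl ?_, fun _ _ => rfl, rfl, rfl⟩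
    funext i
    cases i with
    | acc b => cases b <;> cases hm : s.1.2.mode <;> simp [withWork]
    | _ => simp [withWork]
  | succ j ih =>
    obtain ⟨r, a, h1, h2, h3, h4⟩ := ih
    refine ⟨Function.update r j (.bit false), Function.update a j (r j), ?_, fun i hi => ?_, ?_, ?_⟩
    · rw [Function.iterate_succ_apply', h1]
      simp only [Instr.exec, sweep, h]
      refine Prod.ext rfl ?_
      funext i
      cases i with
      | acc b =>
        by_cases hb : b = s.1.2.mode
        · simp [withWork, moveOffset, add_comm, hb]
        · simp [withWork, moveOffset, add_comm, hb, shift_apply_zero, writeMove_shift]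
      | _ => simp [withWork, moveOffset, add_comm, writeMove_shift]
    · push_cast at hi
      rw [Function.update_of_ne (by omega), h2 i (by omega)]
    · rw [tapeVal_succ_update, h3]; simp [Sym.isOne]
    · rw [tapeVal_succ_update, h4, tapeVal_succ, h2 j le_rfl]

/-- Doubling in place delays each digit of `res` by one cell, so the old digit joins the carry for
the next cell. The invariant is that of schoolbook addition, with the carry weighted by `2 ^ j`. -/
lemma sweep_iterate_add {s : Store V g k m} {b : Bool} (h : s.1.2.op = .add b)
    (hc : s.1.2.carry = 0) (j : ℕ) :
    ∃ (r : ℤ → Sym V g) (c : Fin 3), sweep.exec^[j] s = ((s.1.1, { s.1.2 with carry := c }),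
        withWork s.2 (shift j r) fun b => shift j (s.2 (.acc b))) ∧
      (∀ i : ℤ, j ≤ i → r i = s.2 .res i) ∧
      tapeVal j r + 2 ^ j * (c : ℕ) =
        2 * tapeVal j (s.2 .res) + b.toNat * tapeVal j (s.2 (.acc s.1.2.mode)) := by
  induction j with
  | zero =>
    refine ⟨s.2 .res, 0, Prod.ext (by rw [← hc]; rfl) ?_, fun _ _ => rfl, by simp [tapeVal]⟩
    funext i; cases i <;> simp [withWork]
  | succ j ih =>
    obtain ⟨r, c, h1, h2, h3⟩ := ih
    set A := s.2 (.acc s.1.2.mode) with hA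
    set d : ℕ := (c : ℕ) + (b && (A j).isOne).toNat with hd
    refine ⟨Function.update r j (.bit (decide (d % 2 = 1))),
      Fin.ofNat 3 (d / 2 + (r j).isOne.toNat), ?_, fun i hi => ?_, ?_⟩
    · rw [Function.iterate_succ_apply', h1]
      simp only [Instr.exec, sweep, h]
      refine Prod.ext ?_ ?_
      · simp [withWork, shift_apply_zero, hd, hA]
      funext i
      cases i <;> simp [withWork, moveOffset, add_comm, writeMove_shift, shift_apply_zero, hd, hA]
    · push_cast at hi
      rw [Function.update_of_ne (by omega), h2 i (by omega)]
    · have hlt : d / 2 + (r j).isOne.toNat < 3 := by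
        have h4 := Bool.toNat_le (b && (A j).isOne)
        have h5 := Bool.toNat_le (r j).isOne
        have h6 := c.is_lt
        omega
      have hbit : ((Sym.bit (decide (d % 2 = 1)) : Sym V g).isOne).toNat = d % 2 := by
        rcases Nat.mod_two_eq_zero_or_one d with h | h <;> simp [Sym.isOne, h]
      have hand : (b && (A j).isOne).toNat = b.toNat * (A j).isOne.toNat := by
        cases b <;> simp
      rw [tapeVal_succ_update, hbit, tapeVal_succ, tapeVal_succ, ← h2 j le_rfl]
      have hval : ((Fin.ofNat 3 (d / 2 + (r j).isOne.toNat) : Fin 3) : ℕ) =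
          d / 2 + (r j).isOne.toNat := by
        simp [Fin.ofNat, Nat.mod_eq_of_lt hlt]
      rw [hval]
      have hdm : d = d % 2 + 2 * (d / 2) := (Nat.mod_add_div d 2).symm
      have h7 : 2 ^ j * d = 2 ^ j * (c : ℕ) + 2 ^ j * (b.toNat * (A j).isOne.toNat) := by
        rw [hd, hand]; ring
      have h8 : 2 ^ j * d = 2 ^ j * (d % 2) + 2 ^ j * (2 * (d / 2)) := by
        rw [← mul_add, ← hdm]
      rw [pow_succ]
      linarith [h3, h7, h8]

end Instructions

/-! ### Passes over the work tapes, reading a fraction, and a full round -/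

section Scan

variable {V : Type*} {g k m : ℕ}

/-- The head movements that undo those of `sweep`. -/
def sweepBack : TapeName k → Option Dir
  | .res => some Dir.left
  | .acc _ => some Dir.left
  | _ => none

/-- A pass over the first `W` cells of the work tapes. -/
def pass (W : ℕ) : List (MulInstr V g k m) :=
  List.replicate W sweep ++ List.replicate W (moveHeads sweepBack)

/-- The effect of an operation on the number on the tape `res`. -/
def Op.newRes {R : Type*} [Semiring R] (o : Op) (mode : Bool) (r : R) (a : Bool → R) : R :=
  match o with
  | .skip => r
  | .add b => 2 * r + b.toNat * a mode
  | .flush => 0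

/-- The effect of an operation on the accumulators. -/
def Op.newAcc {R : Type*} (o : Op) (mode : Bool) (r : R) (a : Bool → R) : Bool → R :=
  match o with
  | .flush => fun b => if b = mode then a b else r
  | _ => a

lemma withWork_shift_back (W : ℕ) (τ : TapeName k → ℤ → Sym V g) (r : ℤ → Sym V g)
    (a : Bool → ℤ → Sym V g) :
    (fun i => shift (W * moveOffset (sweepBack i))
      (withWork τ (shift W r) (fun b => shift W (a b)) i)) = withWork τ r a := by
  funext i
  cases i <;> simp [withWork, sweepBack, moveOffset]

lemma execAll_pass (W : ℕ) {s : Store V g k m} (hc : s.1.2.carry = 0) :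
    ∃ (r : ℤ → Sym V g) (a : Bool → ℤ → Sym V g) (c : Fin 3),
      execAll (pass W) s = ((s.1.1, { s.1.2 with carry := c }), withWork s.2 r a) ∧
      (tapeVal W r : ZMod (2 ^ W)) = s.1.2.op.newRes s.1.2.mode (tapeVal W (s.2 .res) : ZMod (2 ^ W))
        (fun b => tapeVal W (s.2 (.acc b))) ∧
      (fun b => (tapeVal W (a b) : ZMod (2 ^ W))) =
        s.1.2.op.newAcc s.1.2.mode (tapeVal W (s.2 .res) : ZMod (2 ^ W))
          (fun b => tapeVal W (s.2 (.acc b))) := by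
  rw [pass, execAll_append, execAll_replicate, execAll_replicate]
  cases h : s.1.2.op with
  | skip =>
    refine ⟨s.2 .res, fun b => s.2 (.acc b), s.1.2.carry, ?_, rfl, rfl⟩
    rw [sweep_iterate_skip h, moveHeads_iterate, withWork_shift_back]
  | add b =>
    obtain ⟨r, c, h1, -, h3⟩ := sweep_iterate_add h hc W
    refine ⟨r, fun b => s.2 (.acc b), c, ?_, ?_, rfl⟩
    · rw [h1, moveHeads_iterate, withWork_shift_back]
    -- The carry dropped at the end of the pass has weight `2 ^ W`, which vanishes modulo `2 ^ W`.
    -- No overflow hypothesis is needed at this stage.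
    · have h4 := congrArg (Nat.cast : ℕ → ZMod (2 ^ W)) h3
      have h5 : (2 : ZMod (2 ^ W)) ^ W = 0 := by
        exact_mod_cast ZMod.natCast_self (2 ^ W)
      push_cast at h4
      rw [h5, zero_mul, add_zero] at h4
      exact h4
  | flush =>
    obtain ⟨r, a, h1, -, h3, h4⟩ := sweep_iterate_flush h W
    refine ⟨r, fun b => if b = s.1.2.mode then s.2 (.acc b) else a, s.1.2.carry, ?_, ?_, ?_⟩
    · rw [h1, moveHeads_iterate, withWork_shift_back]
    · simp [h3, Op.newRes]
    · funext b
      simp only [Op.newAcc]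
      split
      · rfl
      · rw [h4]

/-- The numbers on the work tapes, and the control data that matter for the multiplication. -/
@[ext] structure Summary (R : Type*) where
  mode : Bool
  seen : Bool
  res : R
  acc : Bool → R

/-- The effect on the summary of reading a symbol. -/
def Summary.step {R : Type*} [Semiring R] (c : Sym V g) (α : Summary R) : Summary R where
  mode := c.nextMode α.mode
  seen := α.seen || (α.mode && c.isOne)
  res := c.toOp.newRes (c.nextMode α.mode) α.res α.acc
  acc := c.toOp.newAcc (c.nextMode α.mode) α.res α.acc

/-- The summary of a configuration, modulo `2 ^ W`. -/
def summary (W : ℕ) (s : Store V g k m) : Summary (ZMod (2 ^ W)) where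
  mode := s.1.2.mode
  seen := s.1.2.seen
  res := tapeVal W (s.2 .res)
  acc := fun b => tapeVal W (s.2 (.acc b))

/-- Read and process one symbol of the output of the simulated machine. -/
def process (W : ℕ) : List (MulInstr V g k m) :=
  fetch :: pass W

lemma execAll_process (W : ℕ) (s : Store V g k m) :
    summary W (execAll (process W) s) = (summary W s).step (s.2 (.sim 0) 0) ∧
      (execAll (process W) s).1.2.zero = s.1.2.zero ∧
      (execAll (process W) s).2 .inp = s.2 .inp ∧
      ∀ i, (execAll (process W) s).2 (.sim i) =
        if i = 0 then shift (-1) (s.2 (.sim 0)) else s.2 (.sim i) := by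
  obtain ⟨r, a, c, h1, h2, h3⟩ := execAll_pass W (s := fetch.exec s) rfl
  rw [process, execAll_cons, h1]
  have hres : (fetch.exec s).2 .res = s.2 .res := by simp [fetch, Instr.exec]
  have hacc : ∀ b, (fetch.exec s).2 (.acc b) = s.2 (.acc b) := by simp [fetch, Instr.exec]
  refine ⟨?_, rfl, by simp [fetch, Instr.exec, withWork], fun i => ?_⟩
  · simp only [hres, hacc] at h2 h3
    exact Summary.ext rfl rfl h2 h3
  · by_cases hi : i = 0
    · subst hi
      simp [withWork, fetch, Instr.exec, moveOffset]
    · simp [withWork, fetch, Instr.exec, hi]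

/-- Cells `ℓ - 1, …, 0` are read from right to left, which is a `foldr` over the word; the head ends
one cell to the left of the word. -/
lemma process_iterate (W ℓ : ℕ) (u : ℤ → Sym V g) (s : Store V g k m)
    (hs : s.2 (.sim 0) = shift (ℓ - 1) u) :
    summary W ((execAll (process W))^[ℓ] s) =
        ((List.range ℓ).map fun i : ℕ => u i).foldr Summary.step (summary W s) ∧
      ((execAll (process W))^[ℓ] s).1.2.zero = s.1.2.zero ∧
      ((execAll (process W))^[ℓ] s).2 .inp = s.2 .inp ∧
      ∀ i, ((execAll (process W))^[ℓ] s).2 (.sim i) =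
        if i = 0 then shift (-1) u else s.2 (.sim i) := by
  induction ℓ generalizing s with
  | zero =>
    refine ⟨rfl, rfl, rfl, fun i => ?_⟩
    by_cases hi : i = 0
    · subst hi
      simpa using hs
    · simp [hi]
  | succ ℓ ih =>
    obtain ⟨h1, h2, h3, h4⟩ := execAll_process W s
    obtain ⟨h5, h6, h7, h8⟩ := ih (execAll (process W) s) (by
      rw [h4, if_pos rfl, hs, shift_shift]
      congr 1
      push_cast
      ring)
    rw [Function.iterate_succ_apply]
    refine ⟨?_, h6.trans h2, h7.trans h3, fun i => ?_⟩
    · have hu : s.2 (.sim 0) 0 = u ℓ := by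
        rw [hs, shift_apply_zero]
        congr 1
        push_cast
        ring
      rw [h5, h1, hu, List.range_succ, List.map_append, List.foldr_append]
      rfl
    · rw [h8]
      by_cases hi : i = 0
      · rw [if_pos hi, if_pos hi]
      · rw [if_neg hi, if_neg hi, h4, if_neg hi]

section Fold

variable {R : Type*} [CommSemiring R]

/-- Horner's rule: numerals have the least significant bit first, so reading from the right starts
at the top bit, and each bit doubles `res` and adds the accumulator times the bit. -/
lemma foldr_step_bits (w : List Bool) (α : Summary R) (hα : α.res = 0) :
    (bitWord V g w).foldr Summary.step α = { α with
      res := α.acc α.mode * binVal w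
      seen := α.seen || (α.mode && w.any id) } := by
  induction w with
  | nil => exact Summary.ext rfl (by simp [bitWord]) (by simp [bitWord, binVal, hα]) rfl
  | cons b w ih =>
    rw [bitWord, List.map_cons, List.foldr_cons, ← bitWord, ih]
    refine Summary.ext rfl ?_ ?_ rfl
    · simp only [Summary.step, Sym.isOne, List.any_cons, id]
      cases α.seen <;> cases α.mode <;> cases b <;> simp
    · simp only [Summary.step, Sym.toOp, Op.newRes, Sym.nextMode, binVal_cons]
      push_cast
      ring

lemma foldr_step_blank (n : ℕ) (α : Summary R) :
    (List.replicate n (Sym.blank : Sym V g)).foldr Summary.step α = α := by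
  induction n with
  | zero => rfl
  | succ n ih =>
    rw [List.replicate_succ, List.foldr_cons, ih]
    simp [Summary.step, Sym.nextMode, Sym.isOne, Sym.toOp, Op.newRes, Op.newAcc]

/-- Reading a fraction from right to left multiplies the denominator, and leaves the new numerator
on the tape `res`. -/
lemma foldr_step_fraction (a b : List Bool) (n : ℕ) (α : Summary R) (hα : α.res = 0)
    (hmode : α.mode = false) (hseen : α.seen = false) :
    (bitWord V g a ++ Sym.slash :: bitWord V g b ++ List.replicate n Sym.blank).foldr
      Summary.step α = { mode := true, seen := a.any id, res := α.acc true * binVal a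
                         acc := fun c => if c then α.acc true else α.acc false * binVal b } := by
  rw [List.append_assoc, List.foldr_append, List.cons_append, List.foldr_cons, List.foldr_append,
    foldr_step_blank, foldr_step_bits b α hα, foldr_step_bits]
  · refine Summary.ext ?_ ?_ ?_ ?_
    · simp [Summary.step, Sym.nextMode, hmode]
    · simp [Summary.step, Sym.nextMode, hmode, hseen]
    · simp [Summary.step, Sym.nextMode, hmode, Sym.toOp, Op.newAcc]
    · funext c
      cases c <;> simp [Summary.step, Sym.nextMode, hmode, Sym.toOp, Op.newAcc]
  · simp [Summary.step, Sym.toOp, Op.newRes]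

end Fold

/-- Multiply the numerator by the last factor, and reset the control data. -/
def finish (hm : 0 < m) : MulInstr V g k m := fun s ρ =>
  ((⟨0, hm⟩, { s.2 with
      op := .flush
      carry := 0
      mode := false
      zero := s.2.zero || !s.2.seen
      seen := false }), fun i => (ρ i, none))

/-- Erase a symbol on each of the simulated tapes. -/
def erase (d : Dir) : MulInstr V g k m := fun s ρ =>
  (s, fun
    | .sim _ => (.blank, some d)
    | i => (ρ i, none))

/-- Replace the contents of the simulated tapes. -/
def withSim (τ : TapeName k → ℤ → Sym V g) (f : Fin (k + 1) → ℤ → Sym V g) :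
    TapeName k → ℤ → Sym V g
  | .sim i => f i
  | i => τ i

lemma erase_right_iterate (j : ℕ) (s : Store V g k m) :
    (erase Dir.right).exec^[j] s = (s.1, withSim s.2 fun i p =>
      if -(j : ℤ) ≤ p ∧ p < 0 then .blank else s.2 (.sim i) (p + j)) := by
  induction j with
  | zero =>
    refine Prod.ext rfl ?_
    funext i
    cases i with
    | sim i =>
      funext p
      have : ¬ (0 ≤ p ∧ p < 0) := by omega
      simp [withSim, this]
    | _ => rfl
  | succ j ih =>
    rw [Function.iterate_succ_apply', ih]
    refine Prod.ext rfl ?_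
    funext i
    cases i with
    | sim i =>
      funext p
      simp only [Instr.exec, erase, withSim, writeMove, moveOffset, Function.update_apply]
      push_cast
      split_ifs <;> first | rfl | omega | skip
      exact congrArg _ (by ring)
    | _ => simp [Instr.exec, erase, withSim]

lemma erase_left_iterate (j : ℕ) (s : Store V g k m) :
    (erase Dir.left).exec^[j] s = (s.1, withSim s.2 fun i p =>
      if 0 < p ∧ p ≤ j then .blank else s.2 (.sim i) (p - j)) := by
  induction j with
  | zero =>
    refine Prod.ext rfl ?_
    funext i
    cases i with
    | sim i =>
      funext p
      have : ¬ (0 < p ∧ p ≤ 0) := by omega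
      simp [withSim, this]
    | _ => rfl
  | succ j ih =>
    rw [Function.iterate_succ_apply', ih]
    refine Prod.ext rfl ?_
    funext i
    cases i with
    | sim i =>
      funext p
      simp only [Instr.exec, erase, withSim, writeMove, moveOffset, Function.update_apply]
      push_cast
      split_ifs <;> first | rfl | omega | skip
      exact congrArg _ (by ring)
    | _ => simp [Instr.exec, erase, withSim]

/-- Erase the simulated tapes up to distance `B` from their heads. -/
def clear (B : ℕ) : List (MulInstr V g k m) :=
  List.replicate (B + 1) (erase Dir.right) ++ List.replicate (2 * B + 2) (erase Dir.left)

/-- The two sweeps together erase the cells from `-B` to `B + 1`. The heads need not return, since a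
blank tape looks the same from everywhere. -/
lemma execAll_clear (B : ℕ) (s : Store V g k m)
    (h : ∀ i (p : ℤ), (B : ℤ) < |p| → s.2 (.sim i) p = .blank) :
    execAll (clear B) s = (s.1, withSim s.2 fun _ _ => .blank) := by
  rw [clear, execAll_append, execAll_replicate, execAll_replicate, erase_right_iterate,
    erase_left_iterate]
  refine Prod.ext rfl ?_
  funext i
  cases i with
  | sim i =>
    funext p
    simp only [withSim]
    push_cast
    split_ifs with h1 h2
    · rfl
    · rfl
    · refine h i _ ?_
      rw [lt_abs]
      omega
  | _ => rfl

/-- The head movement to the right on the first simulated tape. -/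
def outRight : TapeName k → Option Dir
  | .sim i => if i = 0 then some Dir.right else none
  | _ => none

/-- Multiply by the local conditional probability of the input symbol at position `t` (which is the
end-of-string symbol behind the input). The machine `q` runs for `T` steps, and its tapes are then
blank beyond distance `L` from their heads. -/
def round (hm : 0 < m) (q : TM k (Sym V g)) (T L W t : ℕ) : List (MulInstr V g k m) :=
  load (t + 1) ++ List.replicate T (simulate q) ++ List.replicate L (moveHeads outRight) ++
    (List.replicate (L + 1) (process W)).flatten ++ finish hm :: pass W ++ clear (L + 1)

/-- The configuration at the beginning of a round. -/
structure Ready (hm : 0 < m) (W : ℕ) (x : List V) (s : Store V g k m) : Prop where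
  state : s.1.1 = ⟨0, hm⟩
  mode : s.1.2.mode = false
  seen : s.1.2.seen = false
  inp : s.2 .inp = wordTape (strWord g x)
  sim : ∀ i, s.2 (.sim i) = fun _ => .blank
  res : (tapeVal W (s.2 .res) : ZMod (2 ^ W)) = 0

/-- The input of the simulated machine in round `t`. -/
def query (g : ℕ) (x : List V) (t : ℕ) : List (Sym V g) :=
  strWord g (x.take t) ++ [nextSym g x[t]?]

/-- Every query is read off the first `t + 1` cells of the input tape: for `t = x.length` the last
of them is the blank behind `x`, which `asNext` turns into `$`. -/
lemma wordTape_query (x : List V) (t : ℕ) (ht : t ≤ x.length) (p : ℤ) :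
    wordTape (query g x t) p =
      if 0 ≤ p ∧ p < (t + 1 : ℕ) then (wordTape (strWord g x) p).asNext else .blank := by
  have hlen : (query g x t).length = t + 1 := by
    simp [query, strWord, ht]
  split_ifs with h
  · obtain ⟨i, rfl⟩ := Int.eq_ofNat_of_zero_le h.1
    have hi : i < t + 1 := by exact_mod_cast h.2
    rw [wordTape_natCast, wordTape_natCast, List.getI_eq_getElem _ (by omega)]
    rcases Nat.lt_succ_iff_lt_or_eq.1 hi with hi' | rfl
    · have h1 : i < (strWord g (x.take t)).length := by
        simp [strWord]; omega
      simp only [query]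
      rw [List.getElem_append_left h1, List.getI_eq_getElem _ (by simp [strWord]; omega)]
      simp [strWord, Sym.asNext]
    · have h1 : (strWord g (x.take i)).length = i := by simp [strWord, ht]
      simp only [query]
      rw [List.getElem_append_right (by omega)]
      rcases ht.lt_or_eq with h2 | rfl
      · rw [List.getI_eq_getElem _ (by simpa [strWord] using h2)]
        simp [strWord, h2, nextSym, Sym.asNext]
      · rw [List.getI_eq_default _ (by simp [strWord])]
        simp only [List.getElem_singleton, List.getElem?_length, nextSym]
        rfl
  · rcases lt_or_ge p 0 with hp | hp
    · rw [wordTape, if_neg (by omega)]; rfl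
    · exact wordTape_eq_default _ _ (by rw [hlen]; omega)

/-- No assumption is made on what `q` outputs, so the round also restores `Ready` after a query
whose prefix has weight zero. -/
lemma execAll_round {hm : 0 < m} {q : TM k (Sym V g)} (hq : ∀ r ∈ q.rules, r.tgt < m)
    {T L W t : ℕ} {x : List V} (ht : t ≤ x.length) (hL : x.length + 1 + T ≤ L)
    {s : Store V g k m} (hs : Ready hm W x s) :
    let α := ((List.range (L + 1)).map fun i : ℕ =>
      ((q.run (query g x t) T).tape 0).nth i).foldr Summary.step (summary W s)
    Ready hm W x (execAll (round hm q T L W t) s) ∧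
      (execAll (round hm q T L W t) s).1.2.zero = (s.1.2.zero || !α.seen) ∧
      (tapeVal W ((execAll (round hm q T L W t) s).2 (.acc false)) : ZMod (2 ^ W)) = α.acc false ∧
      (tapeVal W ((execAll (round hm q T L W t) s).2 (.acc true)) : ZMod (2 ^ W)) = α.res := by
  intro α
  set s₁ := execAll (load (t + 1)) s with hs₁
  have h₁ := execAll_load (t + 1) s
  rw [← hs₁] at h₁
  have hrep : Represents s₁ (TM.init k (query g x t)) := by
    rw [h₁]
    refine ⟨by rw [hs.state]; rfl, fun i => ?_⟩
    rw [TM.init_nth]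
    by_cases hi : i = 0
    · subst hi
      rw [if_pos rfl]
      funext p
      simp only [Function.update_self, hs.inp, hs.sim]
      exact (wordTape_query x t ht p).symm
    · rw [if_neg hi, wordTape_nil]
      simp only
      rw [Function.update_of_ne (by simpa using hi), hs.sim]
      rfl
  obtain ⟨h2, h3, h4⟩ := simulate_iterate hq (query g x t) hrep T
  set s₂ := (simulate q).exec^[T] s₁ with hs₂
  have hq0 : ∀ i (p : ℤ), (L : ℤ) < |p| → s₂.2 (.sim i) p = .blank := by
    intro i p hp
    rw [h2.2]
    refine TM.run_nth_eq_default _ _ _ _ _ ?_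
    have : (query g x t).length = t + 1 := by simp [query, strWord, ht]
    rw [this]
    push_cast
    omega
  set s₃ : Store V g k m := (moveHeads outRight).exec^[L] s₂ with hs₃
  have h5 := moveHeads_iterate outRight L s₂
  rw [← hs₃] at h5
  set u := ((q.run (query g x t) T).tape 0).nth with hu
  have hsum : summary W s₃ = summary W s := by
    refine Summary.ext ?_ ?_ ?_ ?_
    · simp only [summary, h5, h3, h₁]
    · simp only [summary, h5, h3, h₁]
    · simp only [summary, h5]
      rw [h4 _ (by simp), h₁]
      simp [outRight]
    · simp only [summary, h5]
      funext b
      rw [h4 _ (by simp), h₁]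
      simp [outRight]
  -- After `L` moves to the right the head is on cell `L`, the last of the `L + 1` cells to be read.
  obtain ⟨h6, h7, h8, h9⟩ := process_iterate W (L + 1) u s₃ (by
    rw [h5]
    simp [outRight, moveOffset, h2.2, hu])
  rw [hsum] at h6
  set s₄ := (execAll (process W))^[L + 1] s₃ with hs₄
  obtain ⟨r, a, c, h10, h11, h12⟩ := execAll_pass W (s := (finish hm).exec s₄) rfl
  have hfin : ((finish hm).exec s₄).2 = s₄.2 := by
    simp [finish, Instr.exec]
  rw [hfin] at h10 h11 h12
  -- Reading has left the head of the first simulated tape on cell `-1`, so distances from it grow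
  -- by one; hence `L + 1`.
  have hclear : execAll (clear (L + 1)) (execAll (pass W) ((finish hm).exec s₄)) =
      ((execAll (pass W) ((finish hm).exec s₄)).1,
        withSim (execAll (pass W) ((finish hm).exec s₄)).2 fun _ _ => .blank) := by
    refine execAll_clear _ _ fun i p hp => ?_
    rw [h10]
    simp only [withWork]
    rw [h9]
    push_cast at hp
    by_cases hi : i = 0
    · rw [if_pos hi, shift]
      have := hq0 0 (p + -1) (by rw [lt_abs] at hp ⊢; omega)
      rwa [h2.2] at this
    · rw [if_neg hi, h5]
      simp only [outRight, hi, if_false, moveOffset_none, mul_zero, shift_zero]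
      exact hq0 i p (by omega)
  have hround : execAll (round hm q T L W t) s = ((((finish hm).exec s₄).1.1,
      { ((finish hm).exec s₄).1.2 with carry := c }), withSim (withWork s₄.2 r a)
        fun _ _ => .blank) := by
    rw [round, execAll_append, execAll_append, execAll_append, execAll_append, execAll_append,
      execAll_cons, execAll_flatten_replicate, execAll_replicate, execAll_replicate, hclear, h10]
  rw [hround]
  have hinp : s₄.2 .inp = s.2 .inp := by
    rw [h8, h5]
    simp only [outRight, moveOffset_none, mul_zero, shift_zero]
    rw [h4 _ (by simp), h₁]
    simp
  have hzero : s₄.1.2.zero = s.1.2.zero := by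
    rw [h7, h5]
    simp only
    rw [h3, h₁]
  refine ⟨⟨rfl, rfl, rfl, hinp.trans hs.inp, fun _ => rfl, h11⟩, ?_, ?_, ?_⟩
  · have h13 : s₄.1.2.seen = α.seen := congrArg Summary.seen h6
    simp only [finish, Instr.exec, hzero, h13]
  · exact (congrFun h12 false).trans (congrFun (congrArg Summary.acc h6) false)
  · exact (congrFun h12 true).trans (congrArg Summary.res h6)

end Scan

/-! ### Writing the result, and the whole program -/

section Output

variable {V : Type*} {g k m : ℕ}

/-- Write `1` on the accumulators. -/
def start : MulInstr V g k m := fun s ρ =>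
  (s, fun
    | .acc _ => (.bit true, none)
    | i => (ρ i, none))

/-- The digit of the output for a symbol on the accumulator `b`; the output is `0 / (2 ^ W - 1)` if
the product is known to be zero. -/
def outDigit (zero b : Bool) (c : Sym V g) : Bool :=
  if zero then !b else c.isOne

/-- Write a digit of the accumulator `b` on the output tape. -/
def emit (b : Bool) : MulInstr V g k m := fun s ρ =>
  (s, fun
    | .inp => (.bit (outDigit s.2.zero b (ρ (.acc b))), some Dir.right)
    | .acc c => (ρ (.acc c), if c = b then some Dir.right else none)
    | i => (ρ i, none))

/-- Write the fraction bar on the output tape. -/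
def emitSlash : MulInstr V g k m := fun s ρ =>
  (s, fun
    | .inp => (.slash, some Dir.right)
    | i => (ρ i, none))

/-- The head movement to the left on the output tape. -/
def inpLeft : TapeName k → Option Dir
  | .inp => some Dir.left
  | _ => none

lemma emit_iterate (b : Bool) (j : ℕ) (s : Store V g k m) :
    (emit b).exec^[j] s = (s.1, fun
      | .inp => shift j fun p => if 0 ≤ p ∧ p < j then
          .bit (outDigit s.1.2.zero b (s.2 (.acc b) p)) else s.2 .inp p
      | .acc c => if c = b then shift j (s.2 (.acc c)) else s.2 (.acc c)
      | i => s.2 i) := by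
  induction j with
  | zero =>
    refine Prod.ext rfl ?_
    funext i
    cases i with
    | inp =>
      funext p
      have : ¬ (0 ≤ p ∧ p < 0) := by omega
      simp [this]
    | _ => simp
  | succ j ih =>
    rw [Function.iterate_succ_apply', ih]
    refine Prod.ext rfl ?_
    funext i
    cases i with
    | inp =>
      simp only [Instr.exec, emit, if_true, shift_apply_zero, writeMove_shift, moveOffset]
      push_cast
      rw [add_comm (1 : ℤ)]
      congr 1
      funext p
      rw [Function.update_apply]
      by_cases hp : p = j
      · subst hp
        rw [if_pos rfl, if_pos (by omega)]
      · rw [if_neg hp]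
        by_cases hp' : 0 ≤ p ∧ p < j
        · rw [if_pos hp', if_pos (by omega)]
        · rw [if_neg hp', if_neg (by omega)]
    | acc c =>
      by_cases hc : c = b
      · simp [Instr.exec, emit, hc, moveOffset, add_comm]
      · simp [Instr.exec, emit, hc]
    | _ => simp [Instr.exec, emit]

/-- Write the accumulated fraction on the output tape. -/
def output (W : ℕ) : List (MulInstr V g k m) :=
  List.replicate W (emit true) ++ emitSlash :: List.replicate W (emit false) ++
    List.replicate (2 * W + 1) (moveHeads inpLeft)

/-- The binary numeral of width `W` that is written for the accumulator `b`. -/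
def outNumeral (W : ℕ) (b : Bool) (s : Store V g k m) : List Bool :=
  (List.range W).map fun i : ℕ => outDigit s.1.2.zero b (s.2 (.acc b) i)

/-- By `h`, the `2 * W + 1` symbols written cover all of the old input to the right of the head;
moving back by that many cells puts the head at the start of the fraction. -/
lemma execAll_output (W : ℕ) (s : Store V g k m) (h : ∀ i : ℤ, W ≤ i → s.2 .inp i = .blank)
    (i : ℕ) :
    (execAll (output W) s).2 .inp i =
      (bitWord V g (outNumeral W true s) ++
        Sym.slash :: bitWord V g (outNumeral W false s)).getI i := by
  rw [output, execAll_append, execAll_append, execAll_cons, execAll_replicate, execAll_replicate,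
    execAll_replicate, emit_iterate, emit_iterate, moveHeads_iterate]
  simp only [Instr.exec, emitSlash, inpLeft, moveOffset, shift, writeMove, Function.update_apply]
  push_cast
  have hlen : ∀ b, (bitWord V g (outNumeral W b s)).length = W := by
    simp [bitWord, outNumeral]
  rcases lt_trichotomy i W with hi | hi | hi
  · rw [if_neg (by omega), if_neg (by omega), if_pos (by omega),
      List.getI_eq_getElem _ (by simp [hlen]; omega),
      List.getElem_append_left (by rw [hlen]; exact hi)]
    simp only [bitWord, outNumeral, List.getElem_map, List.getElem_range]
    congr 4
    ring_nf
  · rw [if_neg (by omega), if_pos (by omega), List.getI_eq_getElem _ (by simp [hlen]; omega),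
      List.getElem_append_right (by rw [hlen]; omega)]
    simp [hlen, hi]
  · by_cases hi' : i < W + 1 + W
    · rw [if_pos (by omega), List.getI_eq_getElem _ (by simp [hlen]; omega),
        List.getElem_append_right (by rw [hlen]; omega)]
      obtain ⟨d, rfl⟩ := Nat.exists_eq_add_of_lt hi
      have h1 : W + d + 1 - (bitWord V g (outNumeral W true s)).length = d + 1 := by
        rw [hlen]; omega
      simp only [h1, List.getElem_cons_succ]
      simp only [bitWord, outNumeral, List.getElem_map, List.getElem_range]
      have h2 : ((W + d + 1 : ℕ) : ℤ) + (2 * W + 1) * -1 + W + 0 = d := by push_cast; ring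
      rw [h2]
      split
      · rename_i h3
        rw [h3]
      · rfl
    · rw [if_neg (by omega), if_neg (by omega), if_neg (by omega), h _ (by omega),
        List.getI_eq_default _ (by simp [hlen]; omega)]
      rfl

/-- The program for inputs of length `n`. -/
def mulProgram (hm : 0 < m) (q : TM k (Sym V g)) (T L W n : ℕ) : List (MulInstr V g k m) :=
  start :: (List.range (n + 1)).flatMap (round hm q T L W) ++ output W

/-- The initial control data. -/
def startCtl (hm : 0 < m) : Fin m × Ctl :=
  (⟨0, hm⟩, ⟨false, false, false, .skip, 0⟩)

lemma length_round (hm : 0 < m) (q : TM k (Sym V g)) (T L W t : ℕ) :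
    (round hm q T L W t).length = 2 * t + T + 4 * L + (L + 2) * (2 * W + 1) + 8 := by
  simp only [round, load, process, pass, clear, List.length_append, List.length_replicate,
    List.length_cons, List.length_flatten, List.map_replicate, List.sum_replicate, smul_eq_mul]
  ring

lemma length_mulProgram_le (hm : 0 < m) (q : TM k (Sym V g)) (T L W n : ℕ) :
    (mulProgram hm q T L W n).length ≤
      (n + 1) * (2 * n + T + 4 * L + (L + 2) * (2 * W + 1) + 8) + (4 * W + 3) := by
  have h : ((List.range (n + 1)).flatMap (round hm q T L W)).length ≤
      (n + 1) * (2 * n + T + 4 * L + (L + 2) * (2 * W + 1) + 8) := by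
    rw [List.length_flatMap]
    refine (List.sum_le_card_nsmul _ (2 * n + T + 4 * L + (L + 2) * (2 * W + 1) + 8) ?_).trans
      (by simp)
    intro l hl
    obtain ⟨t, ht, rfl⟩ := List.mem_map.1 hl
    rw [length_round]
    have := List.mem_range.1 ht
    omega
  simp only [mulProgram, output, List.length_append, List.length_cons, List.length_replicate]
  omega

end Output

/-! ### The invariant of the multiplication -/

section Correctness

variable {V : Type*} {g k m : ℕ}

lemma map_range_eq_append_replicate {w : List (Sym V g)} {f : ℤ → Sym V g} {n : ℕ}
    (h : ∀ i : ℕ, f i = w.getI i) (hn : w.length ≤ n) :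
    ((List.range n).map fun i : ℕ => f i) = w ++ List.replicate (n - w.length) .blank := by
  refine List.ext_getElem (by simp [hn]) fun i h1 h2 => ?_
  simp only [List.getElem_map, List.getElem_range, h]
  by_cases hi : i < w.length
  · rw [List.getElem_append_left hi, List.getI_eq_getElem _ hi]
  · rw [List.getElem_append_right (by omega), List.getI_eq_default _ (by omega)]
    simp
    rfl

/-- The invariant of the program: the accumulated fraction is `v`, or `v` is zero and the flag for
this is set. -/
def Accumulated (W B : ℕ) (v : ℝ) (s : Store V g k m) : Prop :=
  (s.1.2.zero = true ∧ v = 0) ∨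
    (s.1.2.zero = false ∧ v ≠ 0 ∧ ∃ N D : ℕ, D ≠ 0 ∧ N ≤ 2 ^ B ∧ D ≤ 2 ^ B ∧ v = N / D ∧
      (tapeVal W (s.2 (.acc true)) : ZMod (2 ^ W)) = N ∧
      (tapeVal W (s.2 (.acc false)) : ZMod (2 ^ W)) = D)

/-- The answer of `q` is only trusted while `v ≠ 0`. A zero numerator sets the flag for good, and
otherwise numerator and denominator each grow by at most `L` bits. -/
lemma Accumulated.round {hm : 0 < m} {q : TM k (Sym V g)} (hq : ∀ r ∈ q.rules, r.tgt < m)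
    {T L W t B : ℕ} {x : List V} (ht : t ≤ x.length) (hL : x.length + 1 + T ≤ L)
    {s : Store V g k m} (hs : Ready hm W x s) {v v' : ℝ} (hv : Accumulated W B v s)
    (hzero : v = 0 → v' = 0)
    (hout : v ≠ 0 → ∃ a b : List Bool, binVal b ≠ 0 ∧ v' / v = (binVal a : ℝ) / (binVal b : ℝ) ∧
      ((q.run (query g x t) T).tape 0).right₀ =
        ListBlank.mk (bitWord V g a ++ Sym.slash :: bitWord V g b)) :
    Ready hm W x (execAll (round hm q T L W t) s) ∧
      Accumulated W (B + L) v' (execAll (round hm q T L W t) s) := by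
  obtain ⟨h1, h2, h3, h4⟩ := execAll_round hq ht hL hs
  refine ⟨h1, ?_⟩
  rcases hv with ⟨hz, hv⟩ | ⟨hz, hv, N, D, hD, hNB, hDB, hND, hN', hD'⟩
  · left
    rw [h2, hz]
    exact ⟨rfl, hzero hv⟩
  obtain ⟨a, b, hb, hab, hr⟩ := hout hv
  -- The output has at most `(t + 1) + T + 1 ≤ L + 1` symbols, so it lies within the cells read; as
  -- one symbol is the bar, each numeral has at most `L` bits.
  have hlen := TM.length_le_of_right₀_eq hr (by
    intro c hc
    simp only [bitWord, List.mem_append, List.mem_map, List.mem_cons] at hc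
    rcases hc with ⟨d, -, rfl⟩ | rfl | ⟨d, -, rfl⟩ <;> exact fun h => by cases h)
  have hqlen : (query g x t).length = t + 1 := by simp [query, strWord, ht]
  rw [right₀_eq_mk_iff] at hr
  rw [map_range_eq_append_replicate hr (by omega),
    foldr_step_fraction a b _ (summary W s) hs.res hs.mode hs.seen] at h2 h3 h4
  simp only [List.length_append, List.length_cons, bitWord, List.length_map] at hlen
  have hvv : v' = (N * binVal a : ℕ) / (D * binVal b : ℕ) := by
    rw [div_eq_iff hv, hND] at hab
    rw [hab]
    push_cast
    rw [div_mul_div_comm, mul_comm (binVal a : ℝ), mul_comm (binVal b : ℝ)]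
  have hbound : ∀ (w : List Bool) (n : ℕ), w.length ≤ L → n ≤ 2 ^ B →
      n * binVal w ≤ 2 ^ (B + L) := by
    intro w n hw hn
    rw [pow_add]
    exact Nat.mul_le_mul hn ((binVal_lt w).le.trans (Nat.pow_le_pow_right (by norm_num) hw))
  by_cases ha : a.any id = false
  · left
    refine ⟨by rw [h2, ha]; simp, ?_⟩
    rw [hvv, (binVal_eq_zero_iff a).2 ha]
    simp
  · right
    have ha' : binVal a ≠ 0 := fun h => ha ((binVal_eq_zero_iff a).1 h)
    have hN0 : N ≠ 0 := by
      rintro rfl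
      exact hv (by simpa using hND)
    refine ⟨?_, ?_, N * binVal a, D * binVal b, mul_ne_zero hD hb, hbound a N (by omega) hNB,
      hbound b D (by omega) hDB, hvv, ?_, ?_⟩
    · rw [h2, hz]
      simpa using ha
    · rw [hvv]
      have h5 : (((N * binVal a : ℕ) : ℝ)) ≠ 0 := by exact_mod_cast mul_ne_zero hN0 ha'
      have h6 : (((D * binVal b : ℕ) : ℝ)) ≠ 0 := by exact_mod_cast mul_ne_zero hD hb
      exact div_ne_zero h5 h6
    · rw [h4]
      push_cast
      rw [← hN']
      rfl
    · rw [h3]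
      push_cast
      rw [← hD']
      rfl

lemma natCast_tapeVal_inj {W N : ℕ} {f : ℤ → Sym V g} (hN : N < 2 ^ W)
    (h : (tapeVal W f : ZMod (2 ^ W)) = N) : tapeVal W f = N := by
  rw [ZMod.natCast_eq_natCast_iff', Nat.mod_eq_of_lt hN, Nat.mod_eq_of_lt (tapeVal_lt W f)] at h
  exact h

/-- Since `B < W`, residues modulo `2 ^ W` determine the numerator and denominator. If the flag is
set, `0 / (2 ^ W - 1)` is written, with nonzero denominator because `W > 0`. -/
lemma Accumulated.exists_numerals {W B : ℕ} {v : ℝ} {s : Store V g k m}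
    (h : Accumulated W B v s) (hB : B < W) :
    binVal (outNumeral W false s) ≠ 0 ∧
      v = (binVal (outNumeral W true s) : ℝ) / (binVal (outNumeral W false s) : ℝ) := by
  rcases h with ⟨hz, hv⟩ | ⟨hz, hv, N, D, hD, hNB, hDB, hND, hN', hD'⟩
  · have h1 : binVal (outNumeral W true s) = 0 := by
      rw [binVal_eq_zero_iff]
      simp [outNumeral, outDigit, hz]
    rw [h1, hv]
    refine ⟨?_, by simp⟩
    rw [Ne, binVal_eq_zero_iff]
    simp [outNumeral, outDigit, hz]
    omega
  · have hlt : 2 ^ B < 2 ^ W := Nat.pow_lt_pow_right (by norm_num) hB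
    have h1 : ∀ b, binVal (outNumeral W b s) = tapeVal W (s.2 (.acc b)) := by
      intro b
      rw [← binVal_map_range]
      simp [outNumeral, outDigit, hz]
    rw [h1, h1, natCast_tapeVal_inj (hNB.trans_lt hlt) hN',
      natCast_tapeVal_inj (hDB.trans_lt hlt) hD']
    exact ⟨hD, hND⟩

/-- The program computes the product of the fractions that the simulated machine outputs. -/
lemma exists_execAll_mulProgram {hm : 0 < m} {q : TM k (Sym V g)} (hq : ∀ r ∈ q.rules, r.tgt < m)
    {T L W : ℕ} {x : List V} (hL : x.length + 1 + T ≤ L) (hW : (x.length + 1) * L + 1 ≤ W)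
    (v : ℕ → ℝ) (hv0 : v 0 = 1) (hzero : ∀ t ≤ x.length, v t = 0 → v (t + 1) = 0)
    (hout : ∀ t ≤ x.length, v t ≠ 0 → ∃ a b : List Bool, binVal b ≠ 0 ∧
      v (t + 1) / v t = (binVal a : ℝ) / (binVal b : ℝ) ∧
      ((q.run (query g x t) T).tape 0).right₀ =
        ListBlank.mk (bitWord V g a ++ Sym.slash :: bitWord V g b))
    {τ : TapeName k → ℤ → Sym V g} (hinp : τ .inp = wordTape (strWord g x))
    (hblank : ∀ i, i ≠ .inp → τ i = fun _ => .blank) :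
    ∃ a b : List Bool, binVal b ≠ 0 ∧ v (x.length + 1) = (binVal a : ℝ) / (binVal b : ℝ) ∧
      ∀ i : ℕ, (execAll (mulProgram hm q T L W x.length) (startCtl hm, τ)).2 .inp i =
        (bitWord V g a ++ Sym.slash :: bitWord V g b).getI i := by
  -- The input fits into `W` cells, as `execAll_output` requires.
  have hL0 : x.length ≤ (x.length + 1) * L :=
    (Nat.le_succ _).trans (Nat.le_mul_of_pos_right _ (by omega))
  have h1 : ∀ t ≤ x.length + 1,
      Ready hm W x (execAll ((List.range t).flatMap (round hm q T L W))
          (start.exec (startCtl hm, τ))) ∧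
        Accumulated W (t * L) (v t) (execAll ((List.range t).flatMap (round hm q T L W))
          (start.exec (startCtl hm, τ))) := by
    intro t
    induction t with
    | zero =>
      intro _
      have hone : ∀ b, tapeVal W ((start.exec ((startCtl hm : Fin m × Ctl), τ)).2 (.acc b)) = 1 := by
        intro b
        obtain ⟨W', rfl⟩ : ∃ W', W = W' + 1 := ⟨W - 1, by omega⟩
        rw [tapeVal, Finset.sum_range_succ', Finset.sum_eq_zero]
        · simp [start, Instr.exec, writeMove, Sym.isOne]
        · intro i _
          simp only [start, Instr.exec, writeMove, moveOffset_none, add_zero]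
          rw [Function.update_of_ne (by omega), hblank _ (by simp)]
          simp [Sym.isOne]
      refine ⟨⟨rfl, rfl, rfl, ?_, fun i => ?_, ?_⟩, Or.inr ⟨rfl, by simp [hv0], 1, 1, ?_⟩⟩
      · simp [start, Instr.exec, hinp]
      · simp [start, Instr.exec, hblank]
      · simp [start, Instr.exec, hblank, tapeVal, Sym.isOne]
      · simp [hone, hv0]
    | succ t ih =>
      intro ht
      obtain ⟨h2, h3⟩ := ih (by omega)
      rw [List.range_succ, List.flatMap_append, execAll_append, List.flatMap_singleton,
        add_mul, one_mul]
      exact h3.round hq (by omega) hL h2 (hzero t (by omega)) (hout t (by omega))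
  obtain ⟨h2, h3⟩ := h1 _ le_rfl
  set s := execAll ((List.range (x.length + 1)).flatMap (round hm q T L W))
    (start.exec (startCtl hm, τ)) with hs
  obtain ⟨h4, h5⟩ := h3.exists_numerals (by omega)
  refine ⟨_, _, h4, h5, fun i => ?_⟩
  rw [mulProgram, execAll_append, execAll_cons, ← hs]
  refine execAll_output W s (fun i hi => ?_) i
  rw [h2.inp]
  exact wordTape_eq_default _ _ (by simp only [strWord, List.length_map]; omega)

end Correctness

/-! ### Prefix weights -/

namespace WeightedLanguage

variable {V : Type*}

lemma prefixZ_nil (p : WeightedLanguage V) : p.prefixZ [] = p.Z := by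
  rw [prefixZ, Z]
  exact (Equiv.subtypeUnivEquiv (fun x => List.nil_prefix)).tsum_eq p

lemma prefixZ_eq_tsum_indicator (p : WeightedLanguage V) (y : List V) :
    p.prefixZ y = ∑' x, {x | y <+: x}.indicator p x :=
  tsum_subtype {x | y <+: x} p

/-- A string with prefix `y` either is `y` or continues with exactly one symbol. Summability is
needed to split the `tsum`. -/
lemma prefixZ_eq_add_sum [Fintype V] {p : WeightedLanguage V} (hp : Summable p) (y : List V) :
    p.prefixZ y = p y + ∑ v, p.prefixZ (y ++ [v]) := by
  classical
  have hind : ∀ s : Set (List V), Summable (s.indicator p) := fun s =>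
    NNReal.summable_of_le (fun x => Set.indicator_le_self s p x) hp
  have hpt : ∀ x, {x | y <+: x}.indicator p x =
      ({y} : Set (List V)).indicator p x + ∑ v, {x | y ++ [v] <+: x}.indicator p x := by
    intro x
    by_cases h : y <+: x
    · obtain ⟨z, rfl⟩ := h
      cases z with
      | nil =>
        have h1 : ∀ v, ¬ (y ++ [v] <+: y) := fun v hv => by simpa using hv.length_le
        simp [h1]
      | cons w z =>
        simp [Set.indicator_apply]
    · have h1 : ∀ v, ¬ (y ++ [v] <+: x) := fun v hv => h ((List.prefix_append y [v]).trans hv)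
      have h2 : x ≠ y := by rintro rfl; exact h List.prefix_rfl
      simp [h, h1, h2]
  simp only [prefixZ_eq_tsum_indicator]
  rw [tsum_congr hpt, Summable.tsum_add (hind _) (summable_sum fun v _ => hind _),
    Summable.tsum_finsetSum fun v _ => hind _]
  congr 1
  rw [tsum_eq_single y fun x hx => Set.indicator_of_notMem (by simpa using hx) _]
  simp

/-- The weight of the prefix of length `t` of `x`, or of `x` itself if `t` is larger than the
length of `x`. -/
def partialWeight (p : WeightedLanguage V) (x : List V) (t : ℕ) : ℝ≥0 :=
  if t ≤ x.length then p.prefixZ (x.take t) else p x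

variable [Fintype V] {p : WeightedLanguage V}

lemma partialWeight_succ_le (hp : Summable p) (x : List V) {t : ℕ} (ht : t ≤ x.length) :
    p.partialWeight x (t + 1) ≤ p.partialWeight x t := by
  classical
  rw [partialWeight, partialWeight, if_pos ht, prefixZ_eq_add_sum hp (x.take t)]
  split
  · rename_i h
    rw [← List.take_append_getElem (show t < x.length by omega)]
    exact (Finset.single_le_sum (f := fun v => p.prefixZ (x.take t ++ [v])) (fun _ _ => zero_le)
      (Finset.mem_univ _)).trans le_add_self
  · rw [List.take_of_length_le (by omega)]
    exact le_self_add

/-- The factors telescope. For a letter this is the definition; for `$`, where `t = x.length`, the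
complementary probability is `p x / Z(x)` by `prefixZ_eq_add_sum`. -/
lemma localProb_take (hp : Summable p) (x : List V) {t : ℕ} (ht : t ≤ x.length)
    (h0 : p.partialWeight x t ≠ 0) :
    p.localProb (x.take t) x[t]? =
      (p.partialWeight x (t + 1) : ℝ) / (p.partialWeight x t : ℝ) := by
  rw [partialWeight, if_pos ht] at h0
  rw [partialWeight, partialWeight, if_pos ht]
  rcases ht.lt_or_eq with h | rfl
  · rw [if_pos (by omega), List.getElem?_eq_getElem h, localProb, List.take_append_getElem h]
  · rw [if_neg (by omega), List.getElem?_length, localProb, ← Finset.sum_div]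
    have h1 := congrArg ((↑) : ℝ≥0 → ℝ) (prefixZ_eq_add_sum hp (x.take x.length))
    have h2 : ((p.prefixZ (x.take x.length) : ℝ≥0) : ℝ) ≠ 0 := by exact_mod_cast h0
    rw [eq_div_iff h2, sub_mul, div_mul_cancel₀ _ h2, h1]
    push_cast
    rw [List.take_length]
    ring

end WeightedLanguage

/-! ### Polynomial bounds -/

/-- The function is bounded by a polynomial. -/
def PolyBounded (f : ℕ → ℕ) : Prop :=
  ∃ P : Polynomial ℕ, ∀ n, f n ≤ P.eval n

namespace PolyBounded

variable {f f' : ℕ → ℕ}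

lemma mono (h : PolyBounded f') (hle : ∀ n, f n ≤ f' n) : PolyBounded f := by
  obtain ⟨P, hP⟩ := h
  exact ⟨P, fun n => (hle n).trans (hP n)⟩

lemma eval (P : Polynomial ℕ) : PolyBounded fun n => P.eval n :=
  ⟨P, fun _ => le_rfl⟩

lemma const (c : ℕ) : PolyBounded fun _ => c :=
  ⟨Polynomial.C c, fun _ => by simp⟩

lemma id : PolyBounded fun n => n :=
  ⟨Polynomial.X, fun _ => by simp⟩

lemma add (h : PolyBounded f) (h' : PolyBounded f') : PolyBounded fun n => f n + f' n := by
  obtain ⟨P, hP⟩ := h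
  obtain ⟨Q, hQ⟩ := h'
  exact ⟨P + Q, fun n => by rw [Polynomial.eval_add]; exact Nat.add_le_add (hP n) (hQ n)⟩

lemma mul (h : PolyBounded f) (h' : PolyBounded f') : PolyBounded fun n => f n * f' n := by
  obtain ⟨P, hP⟩ := h
  obtain ⟨Q, hQ⟩ := h'
  exact ⟨P * Q, fun n => by rw [Polynomial.eval_mul]; exact Nat.mul_le_mul (hP n) (hQ n)⟩

end PolyBounded

/-! ### The model that copies its parameters -/

/-- The instruction that changes nothing. -/
def idle (σ ι Γ : Type*) : Instr σ ι Γ :=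
  moveHeads fun _ => none

/-- The parametric model whose parameters are the descriptions of the specialized machines. -/
def copyModel (V : Type*) [Fintype V] (g k : ℕ) : ParametricModel V where
  numAux := g
  tapes := 0
  outTapes := k
  machine := compile (Equiv.refl (Fin (0 + 1))) [idle Unit (Fin (0 + 1)) (Sym V g)] ()

/-- Input and output share tape `0` and its head position, so a single idle step into the halting
state copies. -/
lemma copyModel_constructsWithin {V : Type*} [Fintype V] {g k : ℕ} (r : TM k (Sym V g)) :
    (copyModel V g k).ConstructsWithin r.encode r 1 := by
  refine compile_outputsWithin (Equiv.refl (Fin (0 + 1))) [idle Unit (Fin (0 + 1)) (Sym V g)]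
    (List.cons_ne_nil _ _) () (bitWord V g r.encode) (bitWord V g r.encode) fun i => ?_
  simp [Instr.exec, idle, moveHeads, startTapes, wordTape_natCast]

/-! ### The specialized machines -/

section Multiplier

variable {V : Type*} [Fintype V] {g k : ℕ}

/-- The distance from the heads within which the tapes of the simulated machine are searched. -/
def simRange (n T : ℕ) : ℕ :=
  n + 1 + T

/-- The number of binary digits of the accumulated numerators and denominators. -/
def workWidth (n T : ℕ) : ℕ :=
  (n + 1) * simRange n T + 1

/-- The straight-line program of the machine that multiplies the local conditional probabilities
computed by `q` in time `T`, for strings of length `n`. -/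
def multiplierProgram (q : TM k (Sym V g)) (n T : ℕ) :
    List (MulInstr V g k (q.encode.length + 1)) :=
  mulProgram (Nat.succ_pos _) q T (simRange n T) (workWidth n T) n

/-- The machine that multiplies the local conditional probabilities computed by `q` in time `T`,
for strings of length `n`. -/
def multiplier (e : TapeName k ≃ Fin ((k + 4) + 1)) (q : TM k (Sym V g)) (n T : ℕ) :
    TM (k + 4) (Sym V g) :=
  compile e (multiplierProgram q n T) (startCtl (Nat.succ_pos _))

/-- The program is run on the partial products `v t = partialWeight x t / Z`, whose last value, at
`x.length + 1`, is the normalized weight. -/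
lemma exists_multiplier_outputsWithin {e : TapeName k ≃ Fin ((k + 4) + 1)} (he : e .inp = 0)
    {p : WeightedLanguage V} (hp : p.Normalizable) {q : TM k (Sym V g)} {x : List V} {T : ℕ}
    (hq : ∀ (y : List V) (s : Option V), y.length ≤ x.length → 0 < p.prefixZ y →
      OutputsRat q (strWord g y ++ [nextSym g s]) (p.localProb y s))
    (hT : ∀ (y : List V) (s : Option V), y.length ≤ x.length →
      q.HaltsWithin (strWord g y ++ [nextSym g s]) T) :
    ∃ a b : List Bool, binVal b ≠ 0 ∧
      (p.normalized x : ℝ) = (binVal a : ℝ) / (binVal b : ℝ) ∧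
      (multiplier e q x.length T).OutputsWithin (strWord g x)
        (bitWord V g a ++ Sym.slash :: bitWord V g b) (multiplierProgram q x.length T).length := by
  have hZ : (p.Z : ℝ) ≠ 0 := by exact_mod_cast hp.2.ne'
  have htapes : ∀ i, startTapes e (strWord g x) i =
      wordTape (if i = .inp then strWord g x else []) := by
    intro i
    simp only [startTapes, ← he, e.injective.eq_iff]
  obtain ⟨a, b, hb, hab, hout⟩ := exists_execAll_mulProgram (q := q) (x := x)
    (T := T) (L := simRange x.length T) (W := workWidth x.length T)
    (hm := Nat.succ_pos q.encode.length)
    (fun r hr => (q.tgt_lt_encode_length hr).trans (Nat.lt_succ_self _)) le_rfl le_rfl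
    (fun t => (p.partialWeight x t : ℝ) / (p.Z : ℝ))
    (by simp [WeightedLanguage.partialWeight, WeightedLanguage.prefixZ_nil, hZ])
    (fun t ht h0 => by
      have h1 : p.partialWeight x t = 0 := by
        simpa [hZ, hp.2.ne'] using h0
      have h2 := WeightedLanguage.partialWeight_succ_le hp.1 x ht
      rw [h1, nonpos_iff_eq_zero] at h2
      simp [h2])
    (fun t ht h0 => by
      have h1 : p.partialWeight x t ≠ 0 := by
        rintro h
        simp [h] at h0
      have hlen : (x.take t).length ≤ x.length := by simp
      have hpos : 0 < p.prefixZ (x.take t) := by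
        rw [WeightedLanguage.partialWeight, if_pos ht] at h1
        exact pos_iff_ne_zero.2 h1
      obtain ⟨a, b, hb, hab, u, hu⟩ := hq (x.take t) x[t]? hlen hpos
      refine ⟨a, b, hb, ?_, ?_⟩
      · rw [← hab, WeightedLanguage.localProb_take hp.1 x ht h1, div_div_div_cancel_right₀ hZ]
      -- The correct output is known at some halting time `u`; halted configurations do not change,
      -- so it is also there at the uniform time `T`.
      · rw [query, TM.run_eq_of_halts (hT (x.take t) x[t]? hlen) hu.1]
        exact hu.2)
    (τ := startTapes e (strWord g x)) (by rw [htapes, if_pos rfl])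
    (fun i hi => by rw [htapes, if_neg hi, wordTape_nil]; rfl)
  refine ⟨a, b, hb, ?_, ?_⟩
  · rw [← hab]
    simp [WeightedLanguage.partialWeight, WeightedLanguage.normalized]
  · refine compile_outputsWithin e _ (by simp [multiplierProgram, mulProgram]) _ _ _ fun i => ?_
    rw [← hout i, ← he, e.symm_apply_apply]
    rfl

lemma polyBounded_length_multiplierProgram (q : ℕ → TM k (Sym V g)) {T : ℕ → ℕ}
    (hT : PolyBounded T) : PolyBounded fun n => (multiplierProgram (q n) n (T n)).length := by
  have hL : PolyBounded fun n => simRange n (T n) :=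
    (PolyBounded.id.add (.const 1)).add hT
  have hW : PolyBounded fun n => workWidth n (T n) :=
    ((PolyBounded.id.add (.const 1)).mul hL).add (.const 1)
  refine PolyBounded.mono ?_ fun n => length_mulProgram_le _ _ _ _ _ _
  exact ((PolyBounded.id.add (.const 1)).mul
    ((((((PolyBounded.const 2).mul .id).add hT).add ((PolyBounded.const 4).mul hL)).add
      ((hL.add (.const 2)).mul (((PolyBounded.const 2).mul hW).add (.const 1)))).add
        (.const 8))).add (((PolyBounded.const 4).mul hW).add (.const 3))

/-- The power of the alphabet size in the number of entries is a constant: `k` and `g` do not depend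
on `n`. -/
lemma polyBounded_encode_multiplier (e : TapeName k ≃ Fin ((k + 4) + 1))
    (q : ℕ → TM k (Sym V g)) {T : ℕ → ℕ} (hT : PolyBounded T)
    (hq : PolyBounded fun n => (q n).encode.length) :
    PolyBounded fun n => (multiplier e (q n) n (T n)).encode.length := by
  have hlen := polyBounded_length_multiplierProgram q hT
  have hcard : PolyBounded fun n => Fintype.card (Fin ((q n).encode.length + 1) × Ctl) := by
    simp only [Fintype.card_prod, Fintype.card_fin]
    exact (hq.add (.const 1)).mul (.const _)
  refine PolyBounded.mono ?_ fun n => compile_encode_length_le _ _ _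
  exact (hlen.mul (hcard.mul (.const _))).mul
    (((PolyBounded.const 2).mul ((PolyBounded.const 2).add
      ((hlen.add (.const 1)).mul hcard))).add (.const _))

end Multiplier

end SeqModel

end

/-! ### Efficient local normalization implies compact parameters for the normalized language -/

theorem lemma1 {V : Type*} [Fintype V] (p : SeqModel.WeightedLanguage V)
    (M : SeqModel.ParametricModel V) (θ : ℕ → List Bool)
    (h : M.EfficientlyLocallyNormalizes θ p) :
    SeqModel.EfficientlyComputableWithCompactParameters p.normalized := by
  open SeqModel in
  obtain ⟨hp, q, hq, ⟨Pθ, hθ⟩, ⟨PC, hC⟩, ⟨PT, hT⟩⟩ := h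
  obtain ⟨e, he⟩ := exists_tapeName_equiv M.outTapes
  -- The description of `q n` is an output of `M.machine`, so its length is at most the parameter
  -- length plus the construction time plus one.
  have hqlen : PolyBounded fun n => (q n).encode.length := by
    refine (((PolyBounded.eval Pθ).add (.eval PC)).add (.const 1)).mono fun n => ?_
    have h1 := TM.length_le_of_right₀_eq (hC n).2 (by
      intro c hc
      obtain ⟨b, -, rfl⟩ := List.mem_map.1 hc
      exact fun h => by cases h)
    simp only [bitWord, List.length_map] at h1
    have := hθ n
    omega
  have hout := fun x : List V => exists_multiplier_outputsWithin he hp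
    (fun y s => hq x.length y s) (fun y s => hT x.length y s)
  obtain ⟨P, hP⟩ := polyBounded_length_multiplierProgram q (PolyBounded.eval PT)
  refine ⟨copyModel V M.numAux (M.outTapes + 4),
    fun n => (multiplier e (q n) n (PT.eval n)).encode,
    fun n => multiplier e (q n) n (PT.eval n),
    polyBounded_encode_multiplier e q (.eval PT) hqlen,
    ⟨1, fun n => ?_⟩, fun x => ?_, P, fun x => ?_⟩
  · rw [Polynomial.eval_one]
    exact copyModel_constructsWithin _
  · obtain ⟨a, b, hb, hab, h1⟩ := hout x
    exact ⟨a, b, hb, hab, _, h1⟩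
  · obtain ⟨a, b, -, -, h1⟩ := hout x
    exact (h1.mono (hP x.length)).1
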